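/- **Setting.** Let $X$ and $Y$ be metric spaces and write $\mathbb{R}^+=[0,\infty)$. A (local) semiflow $\pi$ on a space $Z$ is a partially defined map $(t,z)\mapsto z\pi t$ from $\mathbb{R}^+\times Z$ to $Z$ whose domain is open in $\mathbb{R}^+\times Z$, which is continuous on its domain, and which satisfies $z\pi 0=z$ and $z\pi(s+t)=(z\pi t)\pi s$ (both sides being defined or undefined simultaneously). Let $y\mapsto y^t$ be a global semiflow on $Y$, and let $\Phi$ be a partially defined map from $\mathbb{R}^+\times Y\times X$ to $X$ such that $(y,x)\pi t:=(y^t,\Phi(t,y,x))$ is a semiflow on $Y\times X$. Fix $y_0\in Y$ and put $$\mathcal H^+(y_0):=\mathrm{cl}_Y\{y_0^t: t\ge 0\},\quad (t,x)\chi s:=(t+s,\Phi(s,y_0^t,x)),\quad r(t,x):=(y_0^t,x)\qquad (t,s\in\mathbb{R}^+,\ x\in X).$$ For $N\subset Y\times X$ let $\mathrm{Inv}\,N$ be the set of all $u(0)$, where $u:\mathbb{R}\to N$ satisfies $u(t)\pi s=u(t+s)$ for all $t\in\mathbb{R}$, $s\in\mathbb{R}^+$. A closed set $N\subset\mathcal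 H^+(y_0)\times X$ is an isolating neighborhood for $K$ if $K=\mathrm{Inv}\,N$ is contained in the interior of $N$ relative to $\mathcal H^+(y_0)\times X$. A set $M\subset Y\times X$ is strongly admissible if, for all sequences $z_n\in M$ and $t_n\in\mathbb{R}^+$ such that $z_n\pi s$ is defined and lies in $M$ for all $s\in[0,t_n]$, the sequence $z_n\pi t_n$ has a convergent subsequence. An index pair for $(y_0,K)$ is a pair $(N_1,N_2)$ of closed sets $N_2\subset N_1\subset\mathbb{R}^+\times X$ such that: 1. if $p\in N_1$ and $p\chi t$ is undefined or not in $N_1$, then $p\chi s\in N_2$ for some $s\in[0,t]$; 2. if $p\in N_2$ and $p\chi t$ is undefined or not in $N_2$, then $p\chi s$ is defined and not in $N_1$ for some $s\in[0,t]$; 3. $N_1\setminus N_2\subset r^{-1}(N)$ for some strongly admissible isolating neighborhood $N$ for $K$; 4. $r^{-1}(W)\subset N_1\setminus N_2$ for some neighborhood $W$ of $K$ in $\mathcal H^+(y_0)\times X$. The pointed space $(N_1/N_2,N_2)$ is obtained from $N_1$ by collapsing $N_2$ to a point, which is the base point, with the quotient topology (if $N_2=\emptyset$, an isolated base point is added).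 Its points are regarded as subsets of $N_1$, so that distinct index pairs give distinct pointed spaces. If $(N_1,N_2)$ and $(M_1,M_2)$ are index pairs for $(y_0,K)$ with $N_1\subset M_1$ and $N_2\subset M_2$, the inclusion induces a morphism $(N_1/N_2,N_2)\to(M_1/M_2,M_2)$ in the homotopy category of pointed spaces (in which morphisms are base point preserving continuous maps modulo base point preserving homotopy). **Theorem.** Let $K\subset\mathcal H^+(y_0)\times X$ have a strongly admissible isolating neighborhood. Among all subcategories $\mathcal S$ of the homotopy category of pointed spaces such that * the objects of $\mathcal S$ are exactly the pointed spaces $(N_1/N_2,N_2)$, where $(N_1,N_2)$ is an index pair for $(y_0,K)$, and * for all index pairs for $(y_0,K)$ with $(N_1,N_2)\subset(M_1,M_2)$, the inclusion induced morphism $(N_1/N_2,N_2)\to(M_1/M_2,M_2)$ belongs to $\mathcal S$ and is an isomorphism in $\mathcal S$ (that is, it has an inverse belonging to $\mathcal S$), there is a smallest one, the categorial nonautonomous Conley index $\mathrm{Con}(y_0,K)$. It has at least one object, and it is a connected simple system: it is a small category, and for any two of its objects $A,B$ it contains exactly one morphism $A\to B$. -/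

import Mathlib

open CategoryTheory Topology
open scoped NNReal

universe u v w

namespace NonautConley

noncomputable section

/-! ### Semiflows, with `none` playing the role of the symbol "undefined" -/

/-- `π : ℝ⁺ × Z → Z ∪ {undefined}` is a (local) semiflow on `Z`: its domain of definition is open
in `ℝ⁺ × Z`, it is continuous there, `π 0 z = z`, and `π (s + t) z = π s (π t z)`, both sides being
defined or undefined simultaneously. -/
structure IsSemiflow {Z : Type w} [TopologicalSpace Z] (π : ℝ≥0 → Z → Option Z) : Prop where
  isOpen_dom : IsOpen {p : ℝ≥0 × Z | (π p.1 p.2).isSome}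
  continuous : Continuous
    (fun p : {p : ℝ≥0 × Z // (π p.1 p.2).isSome} => (π p.1.1 p.1.2).get p.2)
  zero : ∀ z, π 0 z = some z
  add : ∀ s t z, π (s + t) z = (π t z).bind (π s)

section Invariance

variable {Z : Type w} (π : ℝ≥0 → Z → Option Z)

/-- The largest invariant subset of `N`: the points of `N` through which there passes a solution
`u : ℝ → N` of `π`. -/
def inv (N : Set Z) : Set Z :=
  {z | ∃ u : ℝ → Z, u 0 = z ∧ (∀ t, u t ∈ N) ∧
    ∀ (t : ℝ) (s : ℝ≥0), π s (u t) = some (u (t + s))}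

/-- `M` is strongly admissible: whenever `z n` and `t n` are sequences with
`π [0, t n] (z n) ⊆ M`, the sequence of end points `w n = π (t n) (z n)` has a convergent
subsequence. -/
def StronglyAdmissible [TopologicalSpace Z] (M : Set Z) : Prop :=
  ∀ (z w : ℕ → Z) (t : ℕ → ℝ≥0),
    (∀ n, z n ∈ M) →
    (∀ n, ∀ s ≤ t n, π s (z n) ∈ some '' M) →
    (∀ n, π (t n) (z n) = some (w n)) →
    ∃ (z' : Z) (k : ℕ → ℕ), StrictMono k ∧ Filter.Tendsto (w ∘ k) Filter.atTop (𝓝 z')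

/-- Basic index pairs relative to `π`. The condition "`x π t` does not lie in `A`" includes the
case that `x π t` is undefined, whereas "`x π t` lies in the complement of `A`" means that it is
defined. -/
structure IsBasicIndexPair [TopologicalSpace Z] (N₁ N₂ : Set Z) : Prop where
  subset : N₂ ⊆ N₁
  isClosed_fst : IsClosed N₁
  isClosed_snd : IsClosed N₂
  exit : ∀ x ∈ N₁, ∀ t, π t x ∉ some '' N₁ → ∃ s ≤ t, π s x ∈ some '' N₂
  relInv : ∀ x ∈ N₂, ∀ t, π t x ∉ some '' N₂ → ∃ s ≤ t, π s x ∈ some '' N₁ᶜ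

end Invariance

/-- The interior of `N ⊆ A` relative to the subspace `A`. -/
def relInterior {Z : Type w} [TopologicalSpace Z] (A N : Set Z) : Set Z :=
  {z | z ∈ A ∧ N ∈ 𝓝[A] z}

/-- A skew-product semiflow on `Y × X` over a global semiflow `y ↦ trans t y` on `Y`. -/
structure SkewProductSemiflow (Y : Type v) (X : Type u)
    [TopologicalSpace Y] [TopologicalSpace X] where
  /-- the translation `y ↦ y ^ t` -/
  trans : Flow ℝ≥0 Y
  /-- the cocycle mapping -/
  Φ : ℝ≥0 → Y → X → Option X
  isSemiflow : IsSemiflow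
    (fun (t : ℝ≥0) (z : Y × X) => (Φ t z.1 z.2).map (fun x' => (trans t z.1, x')))

namespace SkewProductSemiflow

variable {Y : Type v} {X : Type u} [TopologicalSpace Y] [TopologicalSpace X]
  (σ : SkewProductSemiflow Y X)

/-- The semiflow on `Y × X`. -/
def flow (t : ℝ≥0) (z : Y × X) : Option (Y × X) :=
  (σ.Φ t z.1 z.2).map (fun x' => (σ.trans t z.1, x'))

/-- The semiflow `χ` on `ℝ⁺ × X` given by `y₀`: `(t, x) χ s = (t + s, Φ (s, y₀ ^ t, x))`. -/
def chi (y₀ : Y) (s : ℝ≥0) (p : ℝ≥0 × X) : Option (ℝ≥0 × X) :=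
  (σ.Φ s (σ.trans p.1 y₀) p.2).map (fun x' => (p.1 + s, x'))

/-- The positive hull of `y₀`. -/
def hull (y₀ : Y) : Set Y := closure (Set.range (fun t : ℝ≥0 => σ.trans t y₀))

/-- The phase space `H⁺(y₀) × X` as a subset of `Y × X`. -/
def hullProd (y₀ : Y) : Set (Y × X) := σ.hull y₀ ×ˢ Set.univ

/-- The mapping `r (t, x) = (y₀ ^ t, x)`. -/
def r (y₀ : Y) (p : ℝ≥0 × X) : Y × X := (σ.trans p.1 y₀, p.2)

/-- `N` is an isolating neighborhood for `K` in `H⁺(y₀) × X`. -/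
structure IsIsolatingNhd (y₀ : Y) (K N : Set (Y × X)) : Prop where
  subset : N ⊆ σ.hullProd y₀
  isClosed : IsClosed N
  inv_subset : inv σ.flow N ⊆ relInterior (σ.hullProd y₀) N
  inv_eq : K = inv σ.flow N

/-- `(N₁, N₂)` is a (strongly admissible) index pair for `(y₀, K)`. -/
structure IsIndexPair (y₀ : Y) (K : Set (Y × X)) (N₁ N₂ : Set (ℝ≥0 × X)) : Prop where
  basic : IsBasicIndexPair (σ.chi y₀) N₁ N₂
  outer : ∃ N, σ.IsIsolatingNhd y₀ K N ∧ StronglyAdmissible σ.flow N ∧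
    N₁ \ N₂ ⊆ σ.r y₀ ⁻¹' N
  inner : ∃ W, W ⊆ σ.hullProd y₀ ∧ K ⊆ relInterior (σ.hullProd y₀) W ∧
    σ.r y₀ ⁻¹' W ⊆ N₁ \ N₂

end SkewProductSemiflow

/-! ### The homotopy category of pointed spaces -/

/-- A pointed topological space. Its underlying set is a set of elements of some type (which may
be all of that type), so that equality of pointed spaces is equality of their sets of points,
topologies and base points, as in set theory. -/
structure PtdSpace : Type (u + 1) where
  ambient : Type u
  carrier : Set ambient
  top : TopologicalSpace carrier
  pt : carrier

namespace PtdSpace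

instance (A : PtdSpace.{u}) : TopologicalSpace A.carrier := A.top

/-- Continuous base point preserving maps. -/
@[ext]
structure Hom (A B : PtdSpace.{u}) : Type u where
  map : C(A.carrier, B.carrier)
  map_pt : map A.pt = B.pt

instance : Category PtdSpace.{u} where
  Hom := Hom
  id A := ⟨ContinuousMap.id _, rfl⟩
  comp f g := ⟨g.map.comp f.map, by simp [f.map_pt, g.map_pt]⟩

/-- Homotopy of pointed maps through pointed maps. -/
def homotopic : HomRel PtdSpace.{u} := fun A _ f g =>
  ContinuousMap.HomotopicRel f.map g.map {A.pt}

instance : Congruence homotopic.{u} where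
  equivalence :=
    { refl := fun f => ContinuousMap.HomotopicRel.refl f.map
      symm := fun h => ContinuousMap.HomotopicRel.symm h
      trans := fun h h' => ContinuousMap.HomotopicRel.trans h h' }
  comp_left := by
    rintro A B C f g g' ⟨H⟩
    refine ⟨⟨⟨⟨fun p => H (p.1, f.map p.2), by fun_prop⟩, fun x => ?_, fun x => ?_⟩, ?_⟩⟩
    · exact H.apply_zero (f.map x)
    · exact H.apply_one (f.map x)
    · rintro t x rfl
      exact H.eq_fst t (x := f.map A.pt) f.map_pt
  comp_right := by
    rintro A B C f f' g h
    exact ContinuousMap.HomotopicRel.comp_continuousMap h g.map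

end PtdSpace

/-- The homotopy category of pointed spaces. -/
abbrev HoPtd := CategoryTheory.Quotient PtdSpace.homotopic.{u}

/-! ### Quotient spaces -/

section Quotients

variable {Z : Type u}

/-- The class of `a ∈ A` for the relation on `A` that identifies all points of `B`. -/
def cls (A B : Set Z) (a : Z) : Set Z := {x | x ∈ A ∧ (x = a ∨ (x ∈ B ∧ a ∈ B))}

/-- The set of points of `A / B`: all classes, and `A ∩ B` (which is an additional, isolated point
if `A ∩ B` is empty). -/
def quotPts (A B : Set Z) : Set (Set Z) := {c | (∃ a ∈ A, c = cls A B a) ∨ c = A ∩ B}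

/-- The canonical projection `A → A / B`. -/
def proj (A B : Set Z) (a : A) : quotPts A B := ⟨cls A B a, Or.inl ⟨a, a.2, rfl⟩⟩

/-- The pointed space `(A / B, A ∩ B)`, with the quotient topology: a set is open if and only if
its preimage in `A` is. -/
def quotSpace [TopologicalSpace Z] (A B : Set Z) : PtdSpace.{u} where
  ambient := Set Z
  carrier := quotPts A B
  top := TopologicalSpace.coinduced (proj A B) inferInstance
  pt := ⟨A ∩ B, Or.inr rfl⟩

open scoped Classical in
/-- The inclusion induced map `A / B → A' / B'` on points. -/
def inclFun (A B A' B' : Set Z) (c : Set Z) : Set Z :=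
  if c = A ∩ B ∨ (c ∩ (A' ∩ B')).Nonempty then A' ∩ B' else c

lemma cls_of_mem {A B : Set Z} {a : Z} (ha : a ∈ A) (hb : a ∈ B) : cls A B a = A ∩ B := by
  ext x; simp only [cls, Set.mem_ofPred_eq, Set.mem_inter_iff]
  constructor
  · rintro ⟨h, rfl | h'⟩
    · exact ⟨h, hb⟩
    · exact ⟨h, h'.1⟩
  · rintro ⟨h, h'⟩; exact ⟨h, Or.inr ⟨h', hb⟩⟩

lemma cls_of_notMem {A B : Set Z} {a : Z} (ha : a ∈ A) (hb : a ∉ B) : cls A B a = {a} := by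
  ext x; simp only [cls, Set.mem_ofPred_eq, Set.mem_singleton_iff]
  constructor
  · rintro ⟨_, h | h'⟩
    · exact h
    · exact absurd h'.2 hb
  · rintro rfl; exact ⟨ha, Or.inl rfl⟩

/-- The inclusion induced map sends the class of `a` to the class of `a`. -/
lemma inclFun_cls {A B A' B' : Set Z} (hA : A ⊆ A') (hB : B ⊆ B') {a : Z} (ha : a ∈ A) :
    inclFun A B A' B' (cls A B a) = cls A' B' a := by
  by_cases hb : a ∈ B
  · rw [cls_of_mem ha hb, cls_of_mem (hA ha) (hB hb)]
    simp [inclFun]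
  · rw [cls_of_notMem ha hb]
    have h1 : ({a} : Set Z) ≠ A ∩ B := fun h => hb (h ▸ Set.mem_singleton a : a ∈ A ∩ B).2
    by_cases hb' : a ∈ B'
    · rw [cls_of_mem (hA ha) hb', inclFun, if_pos]
      exact Or.inr ⟨a, rfl, hA ha, hb'⟩
    · rw [cls_of_notMem (hA ha) hb', inclFun, if_neg]
      rintro (h | ⟨x, hx, hx'⟩)
      · exact h1 h
      · exact hb' ((Set.mem_singleton_iff.1 hx) ▸ hx'.2)

lemma inclFun_pt (A B A' B' : Set Z) : inclFun A B A' B' (A ∩ B) = A' ∩ B' := by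
  simp [inclFun]

lemma inclFun_mem {A B A' B' : Set Z} (hA : A ⊆ A') (hB : B ⊆ B') (c : quotPts A B) :
    inclFun A B A' B' c ∈ quotPts A' B' := by
  obtain ⟨c, ⟨a, ha, rfl⟩ | rfl⟩ := c
  · exact Or.inl ⟨a, hA ha, inclFun_cls hA hB ha⟩
  · exact Or.inr (inclFun_pt A B A' B')

/-- The inclusion induced pointed map `(A / B, A ∩ B) → (A' / B', A' ∩ B')`. -/
def inclMap [TopologicalSpace Z] {A B A' B' : Set Z} (hA : A ⊆ A') (hB : B ⊆ B') :
    quotSpace A B ⟶ quotSpace A' B' where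
  map :=
    { toFun := fun c => ⟨inclFun A B A' B' c.1, inclFun_mem hA hB c⟩
      continuous_toFun := by
        let _ : TopologicalSpace (quotPts A' B') := (quotSpace A' B').top
        have hq : Continuous (proj A' B') := continuous_coinduced_rng
        refine continuous_coinduced_dom.2 ((hq.comp (continuous_inclusion hA)).congr fun a => ?_)
        exact Subtype.ext (inclFun_cls hA hB a.2).symm }
  map_pt := Subtype.ext (inclFun_pt A B A' B')

end Quotients

/-! ### Subcategories and connected simple systems -/

/-- A (not necessarily full or wide) subcategory of `C`. -/
@[ext]
structure Subcat (C : Type v) [Category.{u} C] where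
  obj : Set C
  hom : ∀ A B : C, Set (A ⟶ B)
  src_mem : ∀ {A B : C} {f : A ⟶ B}, f ∈ hom A B → A ∈ obj
  tgt_mem : ∀ {A B : C} {f : A ⟶ B}, f ∈ hom A B → B ∈ obj
  id_mem : ∀ {A : C}, A ∈ obj → 𝟙 A ∈ hom A A
  comp_mem : ∀ {A B D : C} {f : A ⟶ B} {g : B ⟶ D},
    f ∈ hom A B → g ∈ hom B D → f ≫ g ∈ hom A D

namespace Subcat

variable {C : Type v} [Category.{u} C]

instance : PartialOrder (Subcat C) where
  le S T := S.obj ⊆ T.obj ∧ ∀ A B, S.hom A B ⊆ T.hom A B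
  le_refl S := ⟨subset_rfl, fun _ _ => subset_rfl⟩
  le_trans _ _ _ h h' := ⟨h.1.trans h'.1, fun A B => (h.2 A B).trans (h'.2 A B)⟩
  le_antisymm _ _ h h' := Subcat.ext (h.1.antisymm h'.1)
    (funext fun A => funext fun B => (h.2 A B).antisymm (h'.2 A B))

/-- The intersection of a family of subcategories. -/
def inter (F : Set (Subcat C)) : Subcat C where
  obj := {A | ∀ S ∈ F, A ∈ S.obj}
  hom A B := {f | ∀ S ∈ F, f ∈ S.hom A B}
  src_mem h S hS := S.src_mem (h S hS)
  tgt_mem h S hS := S.tgt_mem (h S hS)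
  id_mem h S hS := S.id_mem (h S hS)
  comp_mem h h' S hS := S.comp_mem (h S hS) (h' S hS)

/-- A connected simple system: a small category with exactly one morphism `A ⟶ B` for all objects
`A` and `B`. -/
def IsConnectedSimpleSystem (S : Subcat C) : Prop :=
  Small.{u} S.obj ∧ ∀ A ∈ S.obj, ∀ B ∈ S.obj, ∃! f : A ⟶ B, f ∈ S.hom A B

end Subcat

/-! ### The categorial Conley index -/

namespace SkewProductSemiflow

variable {Y : Type v} {X : Type u} [TopologicalSpace Y] [TopologicalSpace X]
  (σ : SkewProductSemiflow Y X)

/-- The object `(N₁ / N₂, N₂)` of the homotopy category of pointed spaces (for `N₂ ⊆ N₁`). -/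
def quotObj (N₁ N₂ : Set (ℝ≥0 × X)) : HoPtd.{u} :=
  (CategoryTheory.Quotient.functor _).obj (quotSpace N₁ N₂)

/-- The inclusion induced morphism `(N₁ / N₂, N₂) ⟶ (M₁ / M₂, M₂)` of the homotopy category. -/
def inclHom {N₁ N₂ M₁ M₂ : Set (ℝ≥0 × X)} (h₁ : N₁ ⊆ M₁) (h₂ : N₂ ⊆ M₂) :
    quotObj N₁ N₂ ⟶ quotObj M₁ M₂ :=
  (CategoryTheory.Quotient.functor _).map (inclMap h₁ h₂)

/-- The properties that determine the categorial Conley index: the objects of `S` are the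
quotients of index pairs for `(y₀, K)`; all inclusion induced morphisms belong to `S` and are
isomorphisms in `S`, that is, `S` also contains an inverse morphism of each of them. -/
structure ContainsIndex (y₀ : Y) (K : Set (Y × X)) (S : Subcat HoPtd.{u}) : Prop where
  obj_eq : S.obj = {A | ∃ N₁ N₂, σ.IsIndexPair y₀ K N₁ N₂ ∧ A = quotObj N₁ N₂}
  incl_mem : ∀ {N₁ N₂ M₁ M₂ : Set (ℝ≥0 × X)}, σ.IsIndexPair y₀ K N₁ N₂ →
    σ.IsIndexPair y₀ K M₁ M₂ → ∀ (h₁ : N₁ ⊆ M₁) (h₂ : N₂ ⊆ M₂),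
      inclHom h₁ h₂ ∈ S.hom (quotObj N₁ N₂) (quotObj M₁ M₂)
  inv_mem : ∀ {N₁ N₂ M₁ M₂ : Set (ℝ≥0 × X)}, σ.IsIndexPair y₀ K N₁ N₂ →
    σ.IsIndexPair y₀ K M₁ M₂ → ∀ (h₁ : N₁ ⊆ M₁) (h₂ : N₂ ⊆ M₂),
      ∃ g ∈ S.hom (quotObj M₁ M₂) (quotObj N₁ N₂),
        inclHom h₁ h₂ ≫ g = 𝟙 _ ∧ g ≫ inclHom h₁ h₂ = 𝟙 _

/-- The categorial nonautonomous Conley index of `(y₀, K)`. -/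
def Con (y₀ : Y) (K : Set (Y × X)) : Subcat HoPtd.{u} :=
  Subcat.inter {S | σ.ContainsIndex y₀ K S}

end SkewProductSemiflow

end

end NonautConley

namespace NonautConley

/-! ### Local semiflows -/

section Stays

variable {Z : Type w}

/-! For index pairs P, Q and a large time t, the index map from the quotient of P to that of Q moves
x along `χ` to time 3t if the orbit lies in P₁ \ P₂ on [0, 2t] and in Q₁ \ Q₂ on [t, 3t], and sends
x to the base point otherwise. By strong admissibility the middle of a long orbit segment in either
difference is mapped close to K by `r`, so it lies in the other difference
(`IsIndexPair.exists_linked`). Hence the set of moved points is open, and at its boundary the end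
points lie in Q₂ (`isOpen_good`, `good_of_mem_closure`), which gives continuity.

Varying t is a homotopy, P → Q → R at time t is P → R at time 2t (`indexMap_comp`), and the class
belonging to an inclusion is the inclusion (`canon_incl`). So these classes are closed under
composition and contain the inclusions and their inverses. As an index pair can be recovered from
its pointed quotient, they form a subcategory `canonSubcat` with one morphism between any two
objects; it bounds `Con` from above. Inverses are unique, so the intersection `Con` still contains
them and is the smallest subcategory.

Morphisms exist in `Con` because any two index pairs are joined by inclusions N → N' ← R → M' ← M,
where the primes enlarge the exit sets by the points that reach them within a fixed time
(`exists_zigzag`). An index pair exists by a construction in Y × X pulled back along `r`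
(`exists_isIndexPair`). -/

lemma some_mem {A : Set Z} {x : Z} : some x ∈ some '' A ↔ x ∈ A := by simp

lemma mem_mono {A B : Set Z} (h : A ⊆ B) {o : Option Z} (ho : o ∈ some '' A) : o ∈ some '' B :=
  Set.image_mono h ho

lemma mem_compl_of_isSome {A : Set Z} {o : Option Z} (ho : o.isSome) (h : o ∉ some '' A) :
    o ∈ some '' Aᶜ := by
  obtain ⟨x, rfl⟩ := Option.isSome_iff_exists.1 ho
  exact some_mem.2 fun hx => h (some_mem.2 hx)

lemma isSome_of_mem {A : Set Z} {o : Option Z} (ho : o ∈ some '' A) : o.isSome := by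
  obtain ⟨x, _, rfl⟩ := ho; rfl

lemma notMem_of_mem_compl {A : Set Z} {o : Option Z} (ho : o ∈ some '' Aᶜ) : o ∉ some '' A := by
  obtain ⟨x, hx, rfl⟩ := ho; exact fun h => hx (some_mem.1 h)

/-- The orbit of `x` is defined and remains in `A` on `[0, t]`. -/
def Stays (π : ℝ≥0 → Z → Option Z) (A : Set Z) (t : ℝ≥0) (x : Z) : Prop :=
  ∀ s ≤ t, π s x ∈ some '' A

/-- Orbits that remain in `E` do not blow up in finite time. -/
def NoBlowUp (π : ℝ≥0 → Z → Option Z) (E : Set Z) : Prop :=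
  ∀ x b, 0 < b → (∀ s < b, π s x ∈ some '' E) → (π b x).isSome

variable {π : ℝ≥0 → Z → Option Z}

/-- Rescaling [a, a + b] to a fixed compact interval makes the tube argument of
`isOpen_stays_affine` work for moving end points. -/
lemma mem_affine_iff {A : Set Z} {a b : ℝ≥0} {x : Z} :
    (∀ θ ∈ Set.Iic (1 : ℝ≥0), π (a + θ * b) x ∈ some '' A) ↔
      ∀ s, a ≤ s → s ≤ a + b → π s x ∈ some '' A := by
  constructor
  · intro H s hs hs'
    rcases eq_or_ne b 0 with rfl | hb
    · have : s = a := le_antisymm (by simpa using hs') hs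
      simpa [this] using H 0 (by simp)
    · have := H ((s - a) / b) (by
        rw [Set.mem_Iic, div_le_one (pos_iff_ne_zero.2 hb)]; exact tsub_le_iff_left.2 hs')
      rwa [div_mul_cancel₀ _ hb, add_tsub_cancel_of_le hs] at this
  · intro H θ hθ
    exact H _ le_self_add (by gcongr; exact mul_le_of_le_one_left zero_le hθ)

lemma Stays.mono {A B : Set Z} (h : A ⊆ B) {t s : ℝ≥0} (hst : s ≤ t) {x : Z}
    (hx : Stays π A t x) : Stays π B s x :=
  fun a ha => mem_mono h (hx a (ha.trans hst))

end Stays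

namespace IsSemiflow

variable {Z : Type w} [TopologicalSpace Z] {π : ℝ≥0 → Z → Option Z} (h : IsSemiflow π)
include h

lemma add_of_eq {s : ℝ≥0} {z z' : Z} (hz : π s z = some z') (t : ℝ≥0) : π (t + s) z = π t z' := by
  rw [h.add, hz]; rfl

lemma sub_of_eq {s t : ℝ≥0} (hst : s ≤ t) {z z' : Z} (hz : π s z = some z') :
    π t z = π (t - s) z' := by
  rw [← h.add_of_eq hz, tsub_add_cancel_of_le hst]

lemma isSome_of_le {s t : ℝ≥0} (hst : s ≤ t) {z : Z} (ht : (π t z).isSome) : (π s z).isSome := by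
  rw [← tsub_add_cancel_of_le hst, h.add] at ht
  cases hs : π s z <;> simp_all

lemma stays_mem {A : Set Z} {t : ℝ≥0} {x : Z} (hx : Stays π A t x) : x ∈ A := by
  simpa [h.zero] using hx 0 zero_le

lemma stays_shift {A : Set Z} {s t : ℝ≥0} {x y : Z} (hx : Stays π A (t + s) x)
    (hy : π s x = some y) : Stays π A t y := fun a ha => by
  rw [← h.add_of_eq hy]; exact hx _ (by gcongr)

lemma isOpen_mem {O : Set Z} (hO : IsOpen O) :
    IsOpen {p : ℝ≥0 × Z | π p.1 p.2 ∈ some '' O} := by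
  have := h.isOpen_dom.isOpenMap_subtype_val _ (hO.preimage h.continuous)
  convert this using 1
  ext p
  simp only [Set.mem_ofPred_eq, Set.mem_image, Set.mem_preimage, Subtype.exists,
    exists_and_right, exists_eq_right]
  constructor
  · rintro ⟨x, hx, hp⟩
    exact ⟨by rw [← hp]; rfl, by simpa [← hp] using hx⟩
  · rintro ⟨hp, hx⟩
    exact ⟨_, hx, by simp⟩

/-- The default value only makes the map total: the domain is open, so it is not taken near (t, z).
-/
lemma continuousAt_getD {t : ℝ≥0} {z : Z} (hz : (π t z).isSome) :
    ContinuousAt (fun p : ℝ≥0 × Z => (π p.1 p.2).getD p.2) (t, z) := by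
  have : ContinuousOn (fun p : ℝ≥0 × Z => (π p.1 p.2).getD p.2)
      {p : ℝ≥0 × Z | (π p.1 p.2).isSome} := by
    rw [continuousOn_iff_continuous_domRestrict]
    refine h.continuous.congr fun p => ?_
    obtain ⟨y, hy⟩ := Option.isSome_iff_exists.1 p.2
    simp [hy]
  exact this.continuousAt (h.isOpen_dom.mem_nhds hz)

lemma isOpen_stays_affine {O : Set Z} (hO : IsOpen O) :
    IsOpen {p : (ℝ≥0 × ℝ≥0) × Z | ∀ θ ∈ Set.Iic (1 : ℝ≥0),
      π (p.1.1 + θ * p.1.2) p.2 ∈ some '' O} := by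
  have hc : IsCompact (Set.Iic (1 : ℝ≥0)) := by
    rw [← Set.Icc_bot]; exact isCompact_Icc
  refine isOpen_iff_mem_nhds.2 fun p hp => ?_
  refine hc.eventually_forall_of_forall_eventually fun θ hθ => ?_
  have hcont : Continuous fun q : ((ℝ≥0 × ℝ≥0) × Z) × ℝ≥0 =>
      (q.1.1.1 + q.2 * q.1.1.2, q.1.2) := by fun_prop
  exact ((h.isOpen_mem hO).preimage hcont).mem_nhds (hp θ hθ)

lemma isOpen_stays {O : Set Z} (hO : IsOpen O) :
    IsOpen {p : ℝ≥0 × Z | Stays π O p.1 p.2} := by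
  have hc : Continuous fun p : ℝ≥0 × Z => (((0 : ℝ≥0), p.1), p.2) := by fun_prop
  convert (h.isOpen_stays_affine hO).preimage hc using 1
  ext p
  simp only [Set.mem_preimage, Set.mem_ofPred_eq]
  rw [mem_affine_iff]
  simp [Stays]

lemma isOpen_stays_time {O : Set Z} (hO : IsOpen O) (t : ℝ≥0) : IsOpen {x | Stays π O t x} :=
  (h.isOpen_stays hO).preimage (Continuous.prodMk_right t)

/-- Wherever it is defined, a limit of orbits in a closed set is in this set. -/
lemma mem_of_mem_closure_stays {E : Set Z} (hE : IsClosed E) {b s : ℝ≥0} {x : Z}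
    (hx : (b, x) ∈ closure {p : ℝ≥0 × Z | Stays π E p.1 p.2}) (hs : s ≤ b)
    (hd : (π s x).isSome) : π s x ∈ some '' E := by
  by_contra hn
  -- The time is capped at `p.1`, since nearby orbit segments may be shorter than s.
  have hc : Continuous fun p : ℝ≥0 × Z => (min s p.1, p.2) := by fun_prop
  have hmem : (b, x) ∈ (fun p : ℝ≥0 × Z => (min s p.1, p.2)) ⁻¹'
      {p : ℝ≥0 × Z | π p.1 p.2 ∈ some '' Eᶜ} := by
    simpa only [Set.mem_preimage, Set.mem_ofPred_eq, min_eq_left hs] using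
      mem_compl_of_isSome hd hn
  obtain ⟨p, hp, hp'⟩ := mem_closure_iff.1 hx _ ((h.isOpen_mem hE.isOpen_compl).preimage hc) hmem
  exact notMem_of_mem_compl hp (hp' _ (min_le_right _ _))

/-- Otherwise, the domain being open, there is a first time at which the orbit is undefined. Before
it the orbit lies in E, so `NoBlowUp` applies. -/
lemma isSome_of_noBlowUp {E : Set Z} (hE : NoBlowUp π E) {b : ℝ≥0} {x : Z}
    (H : ∀ s ≤ b, (π s x).isSome → π s x ∈ some '' E) : (π b x).isSome := by
  by_contra hb
  set S : Set ℝ≥0 := {s | ¬ (π s x).isSome}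
  have hS : IsClosed S := by
    rw [← isOpen_compl_iff]
    convert h.isOpen_dom.preimage (Continuous.prodMk_left x) using 1
    ext s; simp [S, Option.isSome_iff_ne_none]
  have hmem : sInf S ∈ S := hS.csInf_mem ⟨b, hb⟩ (OrderBot.bddBelow _)
  have hlt : ∀ s < sInf S, (π s x).isSome := fun s hs => by
    by_contra hn; exact notMem_of_lt_csInf hs (OrderBot.bddBelow _) hn
  have hle : sInf S ≤ b := csInf_le (OrderBot.bddBelow _) hb
  refine hmem (hE x _ ?_ fun s hs => H s (hs.le.trans hle) (hlt s hs))
  refine pos_iff_ne_zero.2 fun h0 => hmem ?_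
  rw [h0, h.zero]; rfl

lemma isClosed_stays {E : Set Z} (hE : IsClosed E) (hE' : NoBlowUp π E) :
    IsClosed {p : ℝ≥0 × Z | Stays π E p.1 p.2} := by
  refine isClosed_of_closure_subset fun p hp s hs => ?_
  have key := fun s hs hd => h.mem_of_mem_closure_stays hE (b := p.1) (s := s) (x := p.2) hp hs hd
  exact key s hs (h.isSome_of_noBlowUp hE' fun a ha => key a (ha.trans hs))

lemma mem_of_forall_lt {C : Set Z} (hC : IsClosed C) {a : ℝ≥0} {x : Z} (hx : x ∈ C)
    (hlt : ∀ b < a, π b x ∈ some '' C) (hd : (π a x).isSome) : π a x ∈ some '' C := by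
  rcases eq_or_ne a 0 with rfl | ha
  · rwa [h.zero, some_mem]
  · refine h.mem_of_mem_closure_stays hC (b := a) ?_ le_rfl hd
    have hmem : a ∈ closure (Set.Iio a) := by
      rw [closure_Iio' ⟨0, pos_iff_ne_zero.2 ha⟩]; exact Set.mem_Iic.2 le_rfl
    exact map_mem_closure (f := fun b => (b, x)) (by fun_prop) hmem
      fun b hb s hs => hlt s (lt_of_le_of_lt hs hb)

/-- The first hitting time of a closed set. -/
lemma exists_first {B : Set Z} (hB : IsClosed B) {s : ℝ≥0} {x : Z} (hs : π s x ∈ some '' B) :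
    ∃ a ≤ s, π a x ∈ some '' B ∧ ∀ a' < a, π a' x ∈ some '' Bᶜ := by
  have hd : ∀ a ≤ s, (π a x).isSome := fun a ha => h.isSome_of_le ha (isSome_of_mem hs)
  set S : Set ℝ≥0 := Set.Iic s ∩ {a | π a x ∈ some '' Bᶜ}ᶜ
  have hS : IsClosed S := isClosed_Iic.inter
    ((h.isOpen_mem hB.isOpen_compl).preimage (Continuous.prodMk_left x)).isClosed_compl
  have hmem : sInf S ∈ S := hS.csInf_mem
    ⟨s, Set.mem_Iic.2 le_rfl, fun hn => notMem_of_mem_compl hn hs⟩ (OrderBot.bddBelow _)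
  refine ⟨sInf S, hmem.1, ?_, fun a ha => ?_⟩
  · by_contra hn
    exact hmem.2 (mem_compl_of_isSome (hd _ hmem.1) hn)
  · by_contra hn
    exact notMem_of_lt_csInf ha (OrderBot.bddBelow _) ⟨ha.le.trans hmem.1, hn⟩

end IsSemiflow

/-! ### Orbits in a basic index pair -/

namespace IsBasicIndexPair

variable {Z : Type w} [TopologicalSpace Z] {π : ℝ≥0 → Z → Option Z} {N₁ N₂ : Set Z}

lemma stays_diff (hN : IsBasicIndexPair π N₁ N₂) {t : ℝ≥0} {x : Z} (hx : x ∈ N₁)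
    (ht : Stays π N₂ᶜ t x) : Stays π (N₁ \ N₂) t x := fun s hs => by
  obtain ⟨y, hy, hy'⟩ := ht s hs
  rw [← hy', some_mem]
  refine ⟨?_, hy⟩
  by_contra hn
  obtain ⟨a, ha, ha'⟩ := hN.exit x hx s (by rw [← hy', some_mem]; exact hn)
  exact notMem_of_mem_compl (ht a (ha.trans hs)) ha'

lemma mem_snd (hN : IsBasicIndexPair π N₁ N₂) {t : ℝ≥0} {x : Z} (hx : x ∈ N₂)
    (ht : ∀ s ≤ t, π s x ∉ some '' N₁ᶜ) : π t x ∈ some '' N₂ := by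
  by_contra hn
  obtain ⟨s, hs, hs'⟩ := hN.relInv x hx t hn
  exact ht s hs hs'

/-- An orbit that hits the exit set remains there as long as it does not leave the index pair. -/
lemma mem_snd_of_hit (hN : IsBasicIndexPair π N₁ N₂) (h : IsSemiflow π) {s t : ℝ≥0} (hst : s ≤ t)
    {x : Z} (hx : π s x ∈ some '' N₂)
    (ht : ∀ a, s ≤ a → a ≤ t → π a x ∉ some '' N₁ᶜ) : π t x ∈ some '' N₂ := by
  obtain ⟨y, hy, hxy⟩ := hx
  rw [h.sub_of_eq hst hxy.symm]
  refine hN.mem_snd hy fun a ha => ?_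
  rw [← h.add_of_eq hxy.symm]
  exact ht _ le_add_self (le_tsub_iff_right hst |>.1 ha)

/-- An orbit that does not remain in the complement of the exit set hits the exit set. -/
lemma exists_hit (hN : IsBasicIndexPair π N₁ N₂) {t : ℝ≥0} {x : Z}
    (hx : x ∈ N₁) (ht : ¬ Stays π N₂ᶜ t x) : ∃ s ≤ t, π s x ∈ some '' N₂ := by
  by_contra! hn
  refine ht fun s hs => mem_compl_of_isSome ?_ (hn s hs)
  by_contra hd
  obtain ⟨a, ha, ha'⟩ := hN.exit x hx s fun hm => hd (isSome_of_mem hm)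
  exact hn a (ha.trans hs) ha'

end IsBasicIndexPair

/-! ### Compactness of orbits in strongly admissible sets -/

section Compactness

open Filter

variable {Z : Type w} {π : ℝ≥0 → Z → Option Z}

lemma inv_subset (N : Set Z) : inv π N ⊆ N := by
  rintro z ⟨u, rfl, hu, _⟩; exact hu 0

lemma stays_of_mem_inv {N : Set Z} {z : Z} (hz : z ∈ inv π N) (t : ℝ≥0) :
    Stays π (inv π N) t z := by
  obtain ⟨u, rfl, hu, hu'⟩ := hz
  intro s _
  rw [hu', some_mem]
  refine ⟨fun a => u (a + (0 + s)), by simp, fun a => hu _, fun a b => ?_⟩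
  rw [hu']; congr 2; ring

/-- Iterated preimages `v n` serve as values at time -n. The solution follows the forward orbit of
`v n` from time -n on, and these orbits agree where they overlap (`hsteps`). -/
lemma mem_inv_of_preimages [TopologicalSpace Z] (h : IsSemiflow π) {N A : Set Z}
    (hA : ∀ z ∈ A, ∀ s, π s z ∈ some '' N) (hA' : ∀ z ∈ A, ∃ y ∈ A, π 1 y = some z) :
    A ⊆ inv π N := by
  intro z hz
  choose f hf hf' using hA'
  let v : ℕ → A := fun n => Nat.rec ⟨z, hz⟩ (fun _ y => ⟨f y y.2, hf y y.2⟩) n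
  have hv : ∀ n, π 1 (v (n + 1)).1 = some (v n).1 := fun n => by
    have := hf' (v n).1 (v n).2
    exact this
  choose g hg hg' using fun (z : A) (s : ℝ≥0) => hA z z.2 s
  have hstep : ∀ n s, g (v (n + 1)) (s + 1) = g (v n) s := fun n s => by
    apply Option.some_injective
    rw [hg', hg', h.add_of_eq (hv n)]
  have hsteps : ∀ k n s, g (v (n + k)) (s + k) = g (v n) s := fun k => by
    induction k with
    | zero => intro n s; simp
    | succ k ih =>
      intro n s
      rw [← ih n s, ← hstep (n + k)]
      push_cast; ring_nf
  let u : ℝ → Z := fun t => g (v ⌈-t⌉₊) (t + ⌈-t⌉₊).toNNReal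
  have hu : ∀ (t : ℝ) (n : ℕ), 0 ≤ t + n → u t = g (v n) (t + n).toNNReal := fun t n hn => by
    have hle : ⌈-t⌉₊ ≤ n := Nat.ceil_le.2 (by linarith)
    obtain ⟨k, rfl⟩ := Nat.exists_eq_add_of_le hle
    have h0 : 0 ≤ t + ⌈-t⌉₊ := by linarith [Nat.le_ceil (-t)]
    refine (hsteps k _ _).symm.trans ?_
    congr 1
    push_cast
    rw [← add_assoc, Real.toNNReal_add h0 k.cast_nonneg, Real.toNNReal_natCast]
  refine ⟨u, ?_, fun t => hg _ _, fun t s => ?_⟩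
  · rw [hu 0 0 (by simp)]
    apply Option.some_injective
    rw [hg']
    simp [h.zero, v]
  · have h0 : 0 ≤ t + ⌈-t⌉₊ := by linarith [Nat.le_ceil (-t)]
    rw [hu t ⌈-t⌉₊ h0, hu (t + s) ⌈-t⌉₊ (by linarith [s.2])]
    rw [hg', ← h.add_of_eq (hg' _ _).symm]
    congr 1
    apply NNReal.eq
    push_cast
    rw [Real.coe_toNNReal _ h0, Real.coe_toNNReal _ (by linarith [s.2])]
    ring

variable [TopologicalSpace Z]

lemma StronglyAdmissible.exists_subseq {N : Set Z} (hN : StronglyAdmissible π N)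
    (h : IsSemiflow π) {z w : ℕ → Z} {t : ℕ → ℝ≥0} (hs : ∀ n, Stays π N (t n) (z n))
    (hw : ∀ n, π (t n) (z n) = some (w n)) :
    ∃ (z' : Z) (k : ℕ → ℕ), StrictMono k ∧ Tendsto (w ∘ k) atTop (𝓝 z') :=
  hN z w t (fun n => h.stays_mem (hs n)) hs hw

/-- The points at times increasing to b accumulate at some z. The domain is a neighborhood of (0,
z), so the short remaining time can be bridged. -/
lemma StronglyAdmissible.noBlowUp {N : Set Z} (hN : StronglyAdmissible π N) (h : IsSemiflow π) :
    NoBlowUp π N := by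
  intro x b hb H
  obtain ⟨t, -, ht, ht'⟩ := exists_seq_strictMono_tendsto' hb
  choose w hw using fun n => Option.isSome_iff_exists.1 (isSome_of_mem (H (t n) (ht n).2))
  obtain ⟨z, k, hk, hz⟩ := hN.exists_subseq h (z := fun _ => x) (t := t)
    (fun n s hs => H s (hs.trans_lt (ht n).2)) hw
  have hlim : Tendsto (fun n => (b - t (k n), w (k n))) atTop (𝓝 (0, z)) := by
    refine Tendsto.prodMk_nhds ?_ hz
    have := (tendsto_const_nhds (x := b)).sub (ht'.comp hk.tendsto_atTop)
    simpa using this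
  have hd := hlim.eventually (h.isOpen_dom.mem_nhds (by simp [h.zero]))
  obtain ⟨n, hn⟩ := hd.exists
  rw [h.sub_of_eq (ht (k n)).2.le (hw _)]
  exact hn

lemma stays_of_tendsto (h : IsSemiflow π) {N : Set Z} (hN : IsClosed N)
    (hN' : StronglyAdmissible π N) {w : ℕ → Z} {a : ℝ≥0} (hst : ∀ᶠ n in atTop, Stays π N a (w n))
    {z : Z} (hz : Tendsto w atTop (𝓝 z)) : Stays π N a z := by
  have hlim : Tendsto (fun n => (a, w n)) atTop (𝓝 (a, z)) := tendsto_const_nhds.prodMk_nhds hz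
  exact (h.isClosed_stays hN (hN'.noBlowUp h)).mem_of_tendsto hlim hst

variable [T2Space Z]

/-- Limits of end points of longer and longer orbit segments in `N` whose forward orbits remain in
`N` belong to the largest invariant subset of `N`. -/
lemma mem_inv_of_tendsto_of_stays (h : IsSemiflow π) {N : Set Z} (hN : IsClosed N)
    (hN' : StronglyAdmissible π N) {z w : ℕ → Z} {t : ℕ → ℝ≥0} (ht : Tendsto t atTop atTop)
    (hst : ∀ n, Stays π N (t n) (z n)) (hw : ∀ n, π (t n) (z n) = some (w n))
    {z' : Z} (hz : Tendsto w atTop (𝓝 z')) (hz' : ∀ a, Stays π N a z') : z' ∈ inv π N := by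
  -- The set of all limits of this kind consists of images of its own points at time 1: stop the
  -- segments one unit earlier and pass to a subsequence.
  let A : Set Z := {z' | ∃ (z w : ℕ → Z) (t : ℕ → ℝ≥0), Tendsto t atTop atTop ∧
    (∀ n, Stays π N (t n) (z n)) ∧ (∀ n, π (t n) (z n) = some (w n)) ∧
    Tendsto w atTop (𝓝 z') ∧ ∀ a, Stays π N a z'}
  refine mem_inv_of_preimages h (A := A) (fun z hz s => ?_) ?_ ⟨z, w, t, ht, hst, hw, hz, hz'⟩
  · obtain ⟨_, _, _, _, _, _, _, hz'⟩ := hz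
    exact hz' s s le_rfl
  rintro z' ⟨z, w, t, ht, hst, hw, hz, hz'⟩
  have hd : ∀ n, (π (t n - 1) (z n)).isSome := fun n =>
    h.isSome_of_le tsub_le_self (by rw [hw]; rfl : (π (t n) (z n)).isSome)
  choose v hv using fun n => Option.isSome_iff_exists.1 (hd n)
  obtain ⟨y, k, hk, hy⟩ := hN'.exists_subseq h (t := fun n => t n - 1)
    (fun n => (hst n).mono subset_rfl tsub_le_self) hv
  have ht1 := (ht.comp hk.tendsto_atTop).eventually_ge_atTop 1
  have htk : Tendsto (fun n => t (k n) - 1) atTop atTop := by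
    refine tendsto_atTop.2 fun b => ?_
    filter_upwards [(ht.comp hk.tendsto_atTop).eventually_ge_atTop (b + 1)] with n hn
    exact le_tsub_of_add_le_right hn
  have hy1 : Stays π N 1 y := stays_of_tendsto h hN hN' (by
    filter_upwards [ht1] with n hn
    refine h.stays_shift ?_ (hv (k n))
    rw [add_tsub_cancel_of_le (show 1 ≤ t (k n) from hn)]
    exact hst (k n)) hy
  obtain ⟨y', -, hy'⟩ := hy1 1 le_rfl
  have hlim : Tendsto (fun n => ((1 : ℝ≥0), v (k n))) atTop (𝓝 (1, y)) :=
    tendsto_const_nhds.prodMk_nhds hy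
  have hc := (h.continuousAt_getD (t := 1) (z := y) (by rw [← hy']; rfl)).tendsto.comp hlim
  have heq : (fun p : ℝ≥0 × Z => (π p.1 p.2).getD p.2) ∘ (fun n => ((1 : ℝ≥0), v (k n)))
      =ᶠ[atTop] w ∘ k := by
    filter_upwards [ht1] with n hn
    have : π 1 (v (k n)) = some (w (k n)) := by
      rw [← h.add_of_eq (hv (k n)), add_tsub_cancel_of_le (show 1 ≤ t (k n) from hn), hw]
    simp [this]
  have hlim' := tendsto_nhds_unique (hc.congr' heq) (hz.comp hk.tendsto_atTop)
  have hyz : π 1 y = some z' := by rw [← hlim', ← hy']; rfl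
  refine ⟨y, ⟨z ∘ k, v ∘ k, fun n => t (k n) - 1, htk,
    fun n => (hst (k n)).mono subset_rfl tsub_le_self, fun n => hv (k n), hy, fun a s _ => ?_⟩, hyz⟩
  rcases le_total s 1 with hs | hs
  · exact hy1 s hs
  · rw [h.sub_of_eq hs hyz]
    exact hz' _ _ le_rfl

/-- A limit of points in the middle of longer and longer orbit segments in `N` belongs to the
largest invariant subset of `N`. -/
lemma mem_inv_of_tendsto (h : IsSemiflow π) {N : Set Z} (hN : IsClosed N)
    (hN' : StronglyAdmissible π N) {z w : ℕ → Z} {t s : ℕ → ℝ≥0}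
    (ht : Tendsto t atTop atTop) (hs : Tendsto s atTop atTop)
    (hst : ∀ n, Stays π N (s n + t n) (z n)) (hw : ∀ n, π (t n) (z n) = some (w n))
    {z' : Z} (hz : Tendsto w atTop (𝓝 z')) : z' ∈ inv π N :=
  mem_inv_of_tendsto_of_stays h hN hN' ht (fun n => (hst n).mono subset_rfl le_add_self) hw hz
    fun a => stays_of_tendsto h hN hN' (by
      filter_upwards [hs.eventually_ge_atTop a] with n hn
      exact (h.stays_shift (hst n) (hw n)).mono subset_rfl hn) hz

/-- Long orbit segments in `N` are close to the largest invariant subset in the middle. -/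
lemma exists_stays_imp_mem (h : IsSemiflow π) {N O : Set Z} (hN : IsClosed N)
    (hN' : StronglyAdmissible π N) (hO : IsOpen O) (hNO : inv π N ⊆ O) :
    ∃ T : ℝ≥0, ∀ t ≥ T, ∀ z, Stays π N (2 * t) z → π t z ∈ some '' O := by
  by_contra! hn
  choose t ht z hz hO' using fun n : ℕ => hn n
  have htt : Tendsto t atTop atTop := tendsto_atTop_mono ht tendsto_natCast_atTop_atTop
  have hst : ∀ n, Stays π N (t n + t n) (z n) := fun n => two_mul (t n) ▸ hz n
  choose w hw hw' using fun n => hst n (t n) le_self_add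
  obtain ⟨y, k, hk, hy⟩ := hN'.exists_subseq h
    (fun n => (hst n).mono subset_rfl le_self_add) fun n => (hw' n).symm
  have hyN : y ∈ inv π N := mem_inv_of_tendsto h hN hN' (htt.comp hk.tendsto_atTop)
    (htt.comp hk.tendsto_atTop) (z := z ∘ k) (fun n => hst (k n)) (fun n => (hw' (k n)).symm) hy
  obtain ⟨n, hn⟩ := (hy.eventually (hO.mem_nhds (hNO hyN))).exists
  exact hO' (k n) (by rw [← hw', some_mem]; exact hn)

/-- Full solutions make `x n` the middle of a segment of length 2n in N, so `mem_inv_of_tendsto`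
applies to its cluster points. -/
lemma exists_subseq_inv (h : IsSemiflow π) {N : Set Z} (hN : IsClosed N)
    (hN' : StronglyAdmissible π N) {x : ℕ → Z} (hx : ∀ n, x n ∈ inv π N) :
    ∃ z ∈ inv π N, ∃ k : ℕ → ℕ, StrictMono k ∧ Tendsto (x ∘ k) atTop (𝓝 z) := by
  choose U hU hUN hU' using hx
  let t : ℕ → ℝ≥0 := fun n => n
  have htt : Tendsto t atTop atTop := tendsto_natCast_atTop_atTop
  have hst : ∀ n, Stays π N (t n + t n) (U n (-n)) := fun n s _ => by
    rw [hU', some_mem]; exact hUN _ _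
  have hw : ∀ n, π (t n) (U n (-n)) = some (x n) := fun n => by
    rw [hU', ← hU n]; simp [t]
  obtain ⟨y, k, hk, hy⟩ := hN'.exists_subseq h
    (fun n => (hst n).mono subset_rfl le_self_add) hw
  exact ⟨y, mem_inv_of_tendsto h hN hN' (htt.comp hk.tendsto_atTop)
    (htt.comp hk.tendsto_atTop) (z := fun n => U (k n) (-(k n : ℕ))) (fun n => hst (k n))
    (fun n => hw (k n)) hy, k, hk, hy⟩

end Compactness

/-! ### Maps from and to quotient spaces -/

section QuotSpace

variable {Z : Type u} [TopologicalSpace Z]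

open scoped Classical in
/-- The class of `z`, and the base point if `z ∉ A`. -/
noncomputable def toQuot (A B : Set Z) (z : Z) : (quotSpace A B).carrier :=
  if hz : z ∈ A then proj A B ⟨z, hz⟩ else (quotSpace A B).pt

lemma toQuot_of_mem {A : Set Z} (B : Set Z) {z : Z} (hz : z ∈ A) :
    toQuot A B z = proj A B ⟨z, hz⟩ := dif_pos hz

lemma toQuot_eq_pt {A B : Set Z} {z : Z} (hz : z ∈ B) : toQuot A B z = (quotSpace A B).pt := by
  by_cases hA : z ∈ A
  · rw [toQuot_of_mem B hA]
    exact Subtype.ext (cls_of_mem hA hz)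
  · exact dif_neg hA

lemma coe_toQuot {A B : Set Z} {z : Z} (hz : z ∈ A \ B) : (toQuot A B z).1 = ({z} : Set Z) := by
  rw [toQuot_of_mem B hz.1]
  exact cls_of_notMem hz.1 hz.2

lemma continuousOn_toQuot (A B : Set Z) : ContinuousOn (toQuot A B) A := by
  rw [continuousOn_iff_continuous_domRestrict]
  have : Continuous (Y := (quotSpace A B).carrier) (proj A B) := continuous_coinduced_rng
  exact this.congr fun a => (toQuot_of_mem B a.2).symm

lemma quotSpace_cases {A B : Set Z} (c : (quotSpace A B).carrier) :
    c = (quotSpace A B).pt ∨ ∃ a ∈ A \ B, c = toQuot A B a := by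
  obtain ⟨c, ⟨a, ha, rfl⟩ | rfl⟩ := c
  · by_cases hb : a ∈ B
    · exact Or.inl (Subtype.ext (cls_of_mem ha hb))
    · exact Or.inr ⟨a, ⟨ha, hb⟩, (toQuot_of_mem B ha).symm⟩
  · exact Or.inl rfl

/-- The projection of `A`, together with a point, onto `A / B`. -/
def sumProj (A B : Set Z) : A ⊕ PUnit.{u + 1} → (quotSpace A B).carrier :=
  Sum.elim (proj A B) fun _ => (quotSpace A B).pt

/-- The extra summand covers the base point, which `proj` misses if A ∩ B is empty. -/
lemma isQuotientMap_sumProj (A B : Set Z) : IsQuotientMap (sumProj A B) := by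
  refine (isQuotientMap_iff _).2 ⟨Topology.isCoinducing_iff.2 fun s => ?_, fun c => ?_⟩
  · rw [isOpen_sum_iff]
    exact ⟨fun h => isOpen_coinduced.2 h.1, fun h => ⟨isOpen_coinduced.1 h, isOpen_discrete _⟩⟩
  · obtain ⟨c, ⟨a, ha, rfl⟩ | rfl⟩ := c
    · exact ⟨Sum.inl ⟨a, ha⟩, rfl⟩
    · exact ⟨Sum.inr ⟨⟩, rfl⟩

open scoped Classical in
/-- The map on `A / B` induced by a map on `A`, with value `w` at the base point. -/
noncomputable def quotDesc {W : Type*} (A B : Set Z) (f : Z → W) (w : W)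
    (c : (quotSpace A B).carrier) : W :=
  if h : ∃ a ∈ A \ B, c.1 = ({a} : Set Z) then f h.choose else w

lemma quotDesc_toQuot {W : Type*} {A B : Set Z} (f : Z → W) (w : W) {a : Z} (ha : a ∈ A \ B) :
    quotDesc A B f w (toQuot A B a) = f a := by
  have h : ∃ a' ∈ A \ B, (toQuot A B a).1 = ({a'} : Set Z) := ⟨a, ha, coe_toQuot ha⟩
  rw [quotDesc, dif_pos h]
  congr 1
  exact (Set.singleton_eq_singleton_iff.1 ((coe_toQuot ha).symm.trans h.choose_spec.2)).symm

lemma quotDesc_pt {W : Type*} {A B : Set Z} (f : Z → W) (w : W) :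
    quotDesc A B f w (quotSpace A B).pt = w := by
  refine dif_neg ?_
  rintro ⟨a, ha, h⟩
  have h' : A ∩ B = {a} := h
  exact ha.2 (h'.symm ▸ Set.mem_singleton a : a ∈ A ∩ B).2

/-- The product of a quotient map with a locally compact space is a quotient map, so joint
continuity can be tested before collapsing. The parameter space I is what makes homotopies descend.
-/
lemma continuous_quotDesc {I W : Type*} [TopologicalSpace I] [LocallyCompactSpace I]
    [TopologicalSpace W] {A B : Set Z} {f : I → Z → W} {w : W}
    (hf : Continuous fun p : I × A => f p.1 p.2) (hw : ∀ i, ∀ b ∈ B, f i b = w) :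
    Continuous fun p : I × (quotSpace A B).carrier => quotDesc A B (f p.1) w p.2 := by
  refine (isQuotientMap_sumProj A B).continuous_lift_prod_right
    (g := fun p : I × (quotSpace A B).carrier => quotDesc A B (f p.1) w p.2) ?_
  rw [← Homeomorph.prodSumDistrib.symm.comp_continuous_iff', continuous_sum_dom]
  refine ⟨hf.congr fun p => ?_, continuous_const.congr fun p => (quotDesc_pt _ w).symm⟩
  change _ = quotDesc A B (f p.1) w (proj A B p.2)
  by_cases hB : (p.2 : Z) ∈ B
  · rw [hw _ _ hB, show proj A B p.2 = (quotSpace A B).pt from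
      Subtype.ext (cls_of_mem p.2.2 hB), quotDesc_pt]
  · rw [← toQuot_of_mem B p.2.2, quotDesc_toQuot _ _ ⟨p.2.2, hB⟩]

end QuotSpace

/-! ### Index maps -/

/-- A basic index pair such that orbits in the difference of its members do not blow up. -/
structure TamePair {Z : Type w} [TopologicalSpace Z] (π : ℝ≥0 → Z → Option Z) where
  fst : Set Z
  snd : Set Z
  basic : IsBasicIndexPair π fst snd
  tame : ∃ E, IsClosed E ∧ NoBlowUp π E ∧ fst \ snd ⊆ E

namespace TamePair

variable {Z : Type u} [TopologicalSpace Z] {π : ℝ≥0 → Z → Option Z}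

/-- The difference of the members of the pair. -/
def diff (P : TamePair π) : Set Z := P.fst \ P.snd

/-- From time `t` on, the middle points of orbit segments in one of the pairs lie in the other
one. -/
def Linked (P Q : TamePair π) (T : ℝ≥0) : Prop :=
  ∀ t ≥ T, ∀ x, (Stays π P.diff (2 * t) x → π t x ∈ some '' Q.diff) ∧
    (Stays π Q.diff (2 * t) x → π t x ∈ some '' P.diff)

lemma Linked.symm {P Q : TamePair π} {T : ℝ≥0} (h : P.Linked Q T) : Q.Linked P T :=
  fun t ht x => (h t ht x).symm

lemma Linked.mono {P Q : TamePair π} {T T' : ℝ≥0} (h : P.Linked Q T) (hT : T ≤ T') :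
    P.Linked Q T' :=
  fun t ht x => h t (hT.trans ht) x

lemma linked_self (P : TamePair π) (T : ℝ≥0) : P.Linked P T := fun t _ _ =>
  ⟨fun h => h t (le_mul_of_one_le_left zero_le one_le_two),
    fun h => h t (le_mul_of_one_le_left zero_le one_le_two)⟩

/-- The condition under which the index map at time `t` is given by the flow. -/
def Good (P Q : TamePair π) (t : ℝ≥0) (x : Z) : Prop :=
  Stays π P.diff (2 * t) x ∧ ∀ s, t ≤ s → s ≤ t + 2 * t → π s x ∈ some '' Q.diff

open scoped Classical in
/-- The index map at time `t`, on points. -/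
noncomputable def indexFun (P Q : TamePair π) (t : ℝ≥0) (x : Z) :
    (quotSpace Q.fst Q.snd).carrier :=
  if P.Good Q t x then toQuot Q.fst Q.snd ((π (t + 2 * t) x).getD x)
  else (quotSpace Q.fst Q.snd).pt

section

variable {P Q : TamePair π} {t : ℝ≥0} {x : Z}

lemma indexFun_of_good {y : Z} (h : P.Good Q t x) (hy : π (t + 2 * t) x = some y) :
    P.indexFun Q t x = toQuot Q.fst Q.snd y := by
  simp [indexFun, h, hy]

lemma indexFun_of_not_good (h : ¬ P.Good Q t x) :
    P.indexFun Q t x = (quotSpace Q.fst Q.snd).pt := if_neg h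

variable (hπ : IsSemiflow π)
include hπ

lemma stays_of_forall {A : Set Z} {y : Z} (hy : π t x = some y) {a : ℝ≥0}
    (h : ∀ s, t ≤ s → s ≤ t + a → π s x ∈ some '' A) : Stays π A a y := fun s hs => by
  rw [← hπ.add_of_eq hy]
  exact h _ le_add_self (by rw [add_comm]; gcongr)

lemma forall_of_stays {A : Set Z} {y : Z} (hy : π t x = some y) {a : ℝ≥0}
    (h : Stays π A a y) (s : ℝ≥0) (hs : t ≤ s) (hs' : s ≤ t + a) : π s x ∈ some '' A := by
  rw [hπ.sub_of_eq hs hy]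
  exact h _ (tsub_le_iff_left.2 hs')

/-- Avoiding `P.snd` keeps the orbit in `P.diff`, the link puts it into `Q.diff` at time t, and
avoiding `Q.snd` keeps it there. The right-hand side consists of open conditions. -/
lemma good_iff (h : P.Linked Q t) (hx : x ∈ P.fst) :
    P.Good Q t x ↔ Stays π P.sndᶜ (2 * t) x ∧
      ∀ s, t ≤ s → s ≤ t + 2 * t → π s x ∈ some '' Q.sndᶜ := by
  refine ⟨fun hg => ⟨hg.1.mono (fun _ => And.right) le_rfl,
    fun s hs hs' => mem_mono (fun _ => And.right) (hg.2 s hs hs')⟩, fun ⟨h1, h2⟩ => ?_⟩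
  have h1' := P.basic.stays_diff hx h1
  obtain ⟨y, hy, hy'⟩ := (h t le_rfl x).1 h1'
  exact ⟨h1', forall_of_stays hπ hy'.symm
    (Q.basic.stays_diff hy.1 (stays_of_forall hπ hy'.symm h2))⟩

variable {I : Type*} [TopologicalSpace I] {τ : I → ℝ≥0} (hτ : Continuous τ)
  {T : ℝ≥0} (h : P.Linked Q T) (hT : ∀ i, T ≤ τ i)

include hτ in
-- Tameness prevents limits of good orbits from blowing up; closedness of the first members does the
-- rest.
lemma of_mem_closure_good {p : I × P.fst}
    (hp : p ∈ closure {p : I × P.fst | P.Good Q (τ p.1) p.2}) :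
    Stays π P.fst (2 * τ p.1) p.2 ∧
      ∀ s, τ p.1 ≤ s → s ≤ τ p.1 + 2 * τ p.1 → π s p.2 ∈ some '' Q.fst := by
  have cl : ∀ {f : I × P.fst → ℝ≥0 × Z} {A : Set Z}, ContinuousAt f p →
      (∀ q : I × P.fst, P.Good Q (τ q.1) q.2 → Stays π A (f q).1 (f q).2) →
      f p ∈ closure {p : ℝ≥0 × Z | Stays π A p.1 p.2} := fun hf hA =>
    hf.continuousWithinAt.mem_closure hp fun q hq => hA q hq
  have c1 : Continuous fun q : I × P.fst => (2 * τ q.1, (q.2 : Z)) := by fun_prop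
  obtain ⟨E, hE, hE', hPE⟩ := P.tame
  obtain ⟨F, hF, hF', hQF⟩ := Q.tame
  have s1 : Stays π E (2 * τ p.1) p.2 :=
    (hπ.isClosed_stays hE hE').closure_subset
      (cl c1.continuousAt fun q hq => hq.1.mono hPE le_rfl)
  refine ⟨fun s hs => hπ.mem_of_mem_closure_stays P.basic.isClosed_fst
    (cl c1.continuousAt fun q hq => hq.1.mono (fun _ => And.left) le_rfl) hs
    (isSome_of_mem (s1 s hs)), ?_⟩
  have hd : (π (τ p.1) p.2).isSome :=
    isSome_of_mem (s1 _ (le_mul_of_one_le_left zero_le one_le_two))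
  have c2 : ContinuousAt (fun q : I × P.fst => (2 * τ q.1, (π (τ q.1) q.2).getD q.2)) p := by
    have hc : Continuous fun q : I × P.fst => (τ q.1, (q.2 : Z)) := by fun_prop
    have := ContinuousAt.comp (f := fun q : I × P.fst => (τ q.1, (q.2 : Z))) (x := p)
      (hπ.continuousAt_getD hd) hc.continuousAt
    exact (by fun_prop : Continuous fun q : I × P.fst => 2 * τ q.1).continuousAt.prodMk this
  have key : ∀ q : I × P.fst, P.Good Q (τ q.1) q.2 →
      Stays π Q.diff (2 * τ q.1) ((π (τ q.1) q.2).getD q.2) := fun q hq => by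
    obtain ⟨y, -, hy⟩ := hq.2 _ le_rfl le_self_add
    rw [← hy]
    exact stays_of_forall hπ hy.symm hq.2
  obtain ⟨y, hy⟩ := Option.isSome_iff_exists.1 hd
  have s2 := (hπ.isClosed_stays hF hF').closure_subset
      (cl c2 fun q hq => (key q hq).mono hQF le_rfl)
  have s3 := cl c2 fun q hq => (key q hq).mono (fun _ => And.left) le_rfl
  simp only [hy, Option.getD_some] at s2 s3
  refine forall_of_stays hπ hy fun s hs => ?_
  exact hπ.mem_of_mem_closure_stays Q.basic.isClosed_fst s3 hs (isSome_of_mem (s2 s hs))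

include hτ h hT

lemma isOpen_good : IsOpen {p : I × P.fst | P.Good Q (τ p.1) p.2} := by
  have c1 : Continuous fun q : I × P.fst => (2 * τ q.1, (q.2 : Z)) := by fun_prop
  have c2 : Continuous fun q : I × P.fst => ((τ q.1, 2 * τ q.1), (q.2 : Z)) := by fun_prop
  convert ((hπ.isOpen_stays P.basic.isClosed_snd.isOpen_compl).preimage c1).inter
    ((hπ.isOpen_stays_affine Q.basic.isClosed_snd.isOpen_compl).preimage c2) using 1
  ext q
  simp only [Set.mem_inter_iff, Set.mem_preimage, Set.mem_ofPred_eq]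
  rw [good_iff hπ (h.mono (hT _)) q.2.2, mem_affine_iff]

/-- A limit of good orbits can only fail to be good by hitting an exit set. A hit of `Q.snd` would
persist to the end time, which is excluded. A hit of `P.snd` would persist to time 2t, but that is
the middle of [t, 3t], where the reverse link gives `P.diff`. -/
lemma good_of_mem_closure {p : I × P.fst}
    (hp : p ∈ closure {p : I × P.fst | P.Good Q (τ p.1) p.2})
    (hs : π (τ p.1 + 2 * τ p.1) p.2 ∉ some '' Q.snd) : P.Good Q (τ p.1) p.2 := by
  obtain ⟨h1, h2⟩ := of_mem_closure_good hπ hτ hp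
  have ht : τ p.1 ≤ 2 * τ p.1 := le_mul_of_one_le_left zero_le one_le_two
  have h3 : ∀ s, τ p.1 ≤ s → s ≤ τ p.1 + 2 * τ p.1 → π s p.2 ∈ some '' Q.diff := by
    intro s hs1 hs2
    obtain ⟨y, hy, hy'⟩ := h2 s hs1 hs2
    rw [← hy', some_mem]
    refine ⟨hy, fun hn => hs ?_⟩
    refine Q.basic.mem_snd_of_hit hπ hs2 (by rw [← hy']; exact some_mem.2 hn) fun a ha ha' hm => ?_
    exact notMem_of_mem_compl hm (h2 a (hs1.trans ha) ha')
  refine (good_iff hπ (h.mono (hT _)) p.2.2).2 ⟨fun s hs' => ?_,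
    fun s hs1 hs2 => mem_mono (fun _ => And.right) (h3 s hs1 hs2)⟩
  obtain ⟨y, -, hy⟩ := h1 _ ht
  have h4 := (h _ (hT p.1) y).2 (stays_of_forall hπ hy.symm h3)
  rw [← hπ.add_of_eq hy.symm, ← two_mul] at h4
  obtain ⟨z, hz, hz'⟩ := h1 s hs'
  rw [← hz', some_mem]
  intro hn
  have h5 := P.basic.mem_snd_of_hit hπ hs' (by rw [← hz']; exact some_mem.2 hn)
    fun a _ ha' hm => notMem_of_mem_compl hm (h1 a ha')
  exact notMem_of_mem_compl (mem_mono (fun _ => And.right) h4) h5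

/-- On the frontier of the good set the end point lies in `Q.snd`, so both branches give the base
point there. -/
lemma continuous_indexFun : Continuous fun p : I × P.fst => P.indexFun Q (τ p.1) p.2 := by
  classical
  have ho := isOpen_good hπ hτ h hT
  refine continuous_if (fun p hp => ?_) (fun p hp => ?_) continuousOn_const
  · rw [ho.frontier_eq] at hp
    obtain ⟨y, hy, hy'⟩ := (of_mem_closure_good hπ hτ hp.1).2 _ le_self_add le_rfl
    rw [← hy']
    refine toQuot_eq_pt ?_
    by_contra hn
    exact hp.2 (good_of_mem_closure hπ hτ h hT hp.1 (by rw [← hy', some_mem]; exact hn))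
  · have hev : ∀ q ∈ closure {p : I × P.fst | P.Good Q (τ p.1) p.2},
        (π (τ q.1 + 2 * τ q.1) q.2).getD q.2 ∈ Q.fst := fun q hq => by
      obtain ⟨y, hy, hy'⟩ := (of_mem_closure_good hπ hτ hq).2 _ le_self_add le_rfl
      simpa [← hy'] using hy
    have hd := isSome_of_mem ((of_mem_closure_good hπ hτ hp).2 _ le_self_add le_rfl)
    have hc : Continuous fun q : I × P.fst => (τ q.1 + 2 * τ q.1, (q.2 : Z)) := by fun_prop
    have hc' := ContinuousAt.comp (f := fun q : I × P.fst => (τ q.1 + 2 * τ q.1, (q.2 : Z)))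
      (x := p) (hπ.continuousAt_getD hd) hc.continuousAt
    exact ContinuousWithinAt.comp (t := Q.fst)
      (f := fun q : I × P.fst => (π (τ q.1 + 2 * τ q.1) q.2).getD q.2)
      ((continuousOn_toQuot Q.fst Q.snd) _ (hev p hp)) hc'.continuousWithinAt hev

lemma continuous_quotDesc_indexFun [LocallyCompactSpace I] :
    Continuous fun p : I × (quotSpace P.fst P.snd).carrier =>
      quotDesc P.fst P.snd (P.indexFun Q (τ p.1)) (quotSpace Q.fst Q.snd).pt p.2 := by
  refine continuous_quotDesc (f := fun i => P.indexFun Q (τ i))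
    (continuous_indexFun hπ hτ h hT) fun i b hb => indexFun_of_not_good fun hg => ?_
  exact (hπ.stays_mem hg.1).2 hb

end

variable (hπ : IsSemiflow π)

/-- The index map at time `t`. -/
noncomputable def indexMap (P Q : TamePair π) (t : ℝ≥0) (h : P.Linked Q t) :
    quotSpace P.fst P.snd ⟶ quotSpace Q.fst Q.snd where
  map :=
    { toFun := quotDesc P.fst P.snd (P.indexFun Q t) (quotSpace Q.fst Q.snd).pt
      continuous_toFun := (continuous_quotDesc_indexFun (I := Unit) hπ (τ := fun _ => t)
        continuous_const h fun _ => le_rfl).comp (Continuous.prodMk_right ()) }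
  map_pt := quotDesc_pt _ _

lemma indexMap_pt {P Q : TamePair π} {t : ℝ≥0} (h : P.Linked Q t) :
    (indexMap hπ P Q t h).map (quotSpace P.fst P.snd).pt = (quotSpace Q.fst Q.snd).pt :=
  quotDesc_pt _ _

lemma indexMap_toQuot {P Q : TamePair π} {t : ℝ≥0} (h : P.Linked Q t) {x : Z} (hx : x ∈ P.diff) :
    (indexMap hπ P Q t h).map (toQuot P.fst P.snd x) = P.indexFun Q t x :=
  quotDesc_toQuot _ _ hx

/-- The time is interpolated linearly. It never drops below the smaller of the two times, from which
the pairs are already linked. -/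
lemma homotopic_indexMap (P Q : TamePair π) {t t' : ℝ≥0} (h : P.Linked Q t)
    (h' : P.Linked Q t') :
    PtdSpace.homotopic (indexMap hπ P Q t h) (indexMap hπ P Q t' h') := by
  let τ : unitInterval → ℝ≥0 := fun i =>
    unitInterval.toNNReal (unitInterval.symm i) * t + unitInterval.toNNReal i * t'
  have hτ : Continuous τ := by
    have := unitInterval.toNNReal_continuous
    fun_prop
  have hsum : ∀ i : unitInterval,
      unitInterval.toNNReal (unitInterval.symm i) + unitInterval.toNNReal i = 1 := fun i => by
    apply NNReal.eq; simp [unitInterval.symm]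
  have hT : ∀ i, min t t' ≤ τ i := fun i => by
    calc min t t' = unitInterval.toNNReal (unitInterval.symm i) * min t t' +
        unitInterval.toNNReal i * min t t' := by rw [← add_mul, hsum, one_mul]
      _ ≤ τ i := by
        exact add_le_add (mul_le_mul_right (min_le_left _ _) _)
          (mul_le_mul_right (min_le_right _ _) _)
  have hL : P.Linked Q (min t t') := by
    rcases min_choice t t' with hm | hm <;> rwa [hm]
  refine ⟨⟨⟨⟨_, continuous_quotDesc_indexFun hπ hτ hL hT⟩, fun c => ?_, fun c => ?_⟩, ?_⟩⟩
  · have : τ 0 = t := by simp [τ]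
    change quotDesc _ _ (P.indexFun Q (τ 0)) _ c = _
    rw [this]; rfl
  · have : τ 1 = t' := by simp [τ]
    change quotDesc _ _ (P.indexFun Q (τ 1)) _ c = _
    rw [this]; rfl
  · rintro i c rfl
    exact (quotDesc_pt _ _).trans (quotDesc_pt _ _).symm

lemma hom_ext {A B A' B' : Set Z} {f g : quotSpace A B ⟶ quotSpace A' B'}
    (h : ∀ a ∈ A \ B, f.map (toQuot A B a) = g.map (toQuot A B a)) : f = g := by
  refine PtdSpace.Hom.ext (ContinuousMap.ext fun c => ?_)
  obtain rfl | ⟨a, ha, rfl⟩ := quotSpace_cases c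
  · rw [f.map_pt, g.map_pt]
  · exact h a ha

lemma comp_map {A B C : PtdSpace.{u}} (f : A ⟶ B) (g : B ⟶ C) (c : A.carrier) :
    (f ≫ g).map c = g.map (f.map c) := rfl

lemma inclMap_toQuot {A B A' B' : Set Z} (hA : A ⊆ A') (hB : B ⊆ B') {a : Z} (ha : a ∈ A) :
    (inclMap hA hB).map (toQuot A B a) = toQuot A' B' a := by
  rw [toQuot_of_mem B ha, toQuot_of_mem B' (hA ha)]
  exact Subtype.ext (inclFun_cls hA hB ha)

lemma good_self_iff {P : TamePair π} {t : ℝ≥0} {x : Z} :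
    P.Good P t x ↔ Stays π P.diff (t + 2 * t) x := by
  refine ⟨fun h s hs => ?_, fun h => ⟨h.mono subset_rfl le_add_self, fun s _ hs => h s hs⟩⟩
  rcases le_total s t with hst | hst
  · exact h.1 s (hst.trans (le_mul_of_one_le_left zero_le one_le_two))
  · exact h.2 s hst hs

lemma indexMap_zero (P : TamePair π) : indexMap hπ P P 0 (P.linked_self 0) = 𝟙 _ := by
  refine hom_ext fun a ha => ?_
  have hg : P.Good P 0 a := good_self_iff.2 fun s hs => by
    rw [nonpos_iff_eq_zero.1 (hs.trans_eq (by simp)), hπ.zero, some_mem]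
    exact ha
  rw [indexMap_toQuot hπ _ ha, indexFun_of_good hg (by simpa using hπ.zero a)]
  rfl

include hπ in
-- Both sides amount to `P.diff` on [0, 4t], `Q.diff` on [t, 5t] and `R.diff` on [2t, 6t]. The left
-- side lacks the condition on Q, the right side that on P after 2t and that on R before 4t; `mid`
-- supplies them by linking on windows [s - t, s + t].
lemma good_comp_iff {P Q R : TamePair π} {t : ℝ≥0} (h : P.Linked Q t) (h' : Q.Linked R t)
    {x : Z} :
    P.Good R (2 * t) x ↔ P.Good Q t x ∧ ∃ y, π (t + 2 * t) x = some y ∧ Q.Good R t y := by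
  have mid : ∀ {A B : TamePair π} {s}, A.Linked B t → t ≤ s →
      (∀ a, s ≤ a + t → a ≤ s + t → π a x ∈ some '' A.diff) → π s x ∈ some '' B.diff := by
    intro A B s hAB hs hA
    have hd := isSome_of_mem (hA (s - t) (by rw [tsub_add_cancel_of_le hs])
      (tsub_le_self.trans le_self_add))
    obtain ⟨y, hy⟩ := Option.isSome_iff_exists.1 hd
    have := (hAB t le_rfl y).1 (stays_of_forall hπ hy fun a ha ha' => hA a
      (tsub_le_iff_right.1 ha) (ha'.trans (by rw [two_mul, ← add_assoc, tsub_add_cancel_of_le hs])))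
    rwa [← hπ.add_of_eq hy, add_tsub_cancel_of_le hs] at this
  constructor
  · rintro ⟨h1, h2⟩
    have h3 : ∀ s, t ≤ s → s ≤ 5 * t → π s x ∈ some '' Q.diff := fun s hs hs' => by
      rcases le_total s (3 * t) with h3t | h3t
      · exact mid h hs fun a _ ha' => h1 a (ha'.trans (by
          calc s + t ≤ 3 * t + t := by gcongr
            _ = 2 * (2 * t) := by ring))
      · refine mid h'.symm hs fun a ha ha' => h2 a ?_ (ha'.trans ?_)
        · refine le_of_add_le_add_right (a := t) (le_trans (le_trans ?_ h3t) ha)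
          exact (by ring : 2 * t + t = 3 * t).le
        · calc s + t ≤ 5 * t + t := by gcongr
            _ = 2 * t + 2 * (2 * t) := by ring
    refine ⟨⟨h1.mono subset_rfl ?_, fun s hs hs' => h3 s hs (hs'.trans ?_)⟩, ?_⟩
    · gcongr; exact le_mul_of_one_le_left zero_le one_le_two
    · calc t + 2 * t = 3 * t := by ring
        _ ≤ 5 * t := by gcongr; norm_num
    have e3 : t + 2 * t = 3 * t := by ring
    obtain ⟨y, -, hy⟩ := h3 (t + 2 * t) le_self_add (by rw [e3]; gcongr; norm_num)
    refine ⟨y, hy.symm, fun s hs => ?_, fun s hs hs' => ?_⟩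
    · rw [← hπ.add_of_eq hy.symm]
      refine h3 _ (le_self_add.trans le_add_self) ?_
      calc s + (t + 2 * t) ≤ 2 * t + (t + 2 * t) := by gcongr
        _ = 5 * t := by ring
    · rw [← hπ.add_of_eq hy.symm]
      refine h2 _ (le_add_self.trans le_add_self) ?_
      calc s + (t + 2 * t) ≤ (t + 2 * t) + (t + 2 * t) := by gcongr
        _ = 2 * t + 2 * (2 * t) := by ring
  · rintro ⟨⟨h1, h2⟩, y, hy, h3, h4⟩
    have h5 : ∀ s, t ≤ s → s ≤ 5 * t → π s x ∈ some '' Q.diff := fun s hs hs' => by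
      rcases le_total s (t + 2 * t) with h3t | h3t
      · exact h2 s hs h3t
      · exact forall_of_stays hπ hy h3 s h3t (hs'.trans_eq (by ring))
    have h6 : ∀ s, 2 * t ≤ s → s ≤ 4 * t → ∀ a, s ≤ a + t → a ≤ s + t →
        π a x ∈ some '' Q.diff := fun s hs hs' a ha ha' => by
      refine h5 a (le_of_add_le_add_right (a := t) (le_trans ?_ ha)) (ha'.trans ?_)
      · rwa [← two_mul]
      · calc s + t ≤ 4 * t + t := by gcongr
          _ = 5 * t := by ring
    have ht : t ≤ 2 * t := le_mul_of_one_le_left zero_le one_le_two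
    refine ⟨fun s hs => ?_, fun s hs hs' => ?_⟩
    · rcases le_total s (2 * t) with h2t | h2t
      · exact h1 s h2t
      · exact mid h.symm (ht.trans h2t) (h6 s h2t (hs.trans_eq (by ring)))
    · rcases le_total s (4 * t) with h4t | h4t
      · exact mid h' (ht.trans hs) (h6 s hs h4t)
      · have e : t + 2 * t + t = 4 * t := by ring
        have h7 : t + 2 * t ≤ s := le_trans (le_self_add.trans e.le) h4t
        rw [hπ.sub_of_eq h7 hy]
        refine h4 _ ?_ ?_
        · rw [le_tsub_iff_left h7, e]; exact h4t
        · exact tsub_le_iff_left.2 (hs'.trans_eq (by ring))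

lemma indexMap_comp {P Q R : TamePair π} {t : ℝ≥0} (h : P.Linked Q t) (h' : Q.Linked R t)
    (h'' : P.Linked R (2 * t)) :
    indexMap hπ P Q t h ≫ indexMap hπ Q R t h' = indexMap hπ P R (2 * t) h'' := by
  refine hom_ext fun a ha => ?_
  rw [comp_map, indexMap_toQuot hπ h ha, indexMap_toQuot hπ h'' ha]
  by_cases hg : P.Good Q t a
  · obtain ⟨y, hy, hy'⟩ := hg.2 _ le_self_add le_rfl
    rw [indexFun_of_good hg hy'.symm, indexMap_toQuot hπ h' hy]
    by_cases hg' : Q.Good R t y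
    · obtain ⟨z, hz, hz'⟩ := hg'.2 _ le_self_add le_rfl
      rw [indexFun_of_good hg' hz'.symm, indexFun_of_good
        ((good_comp_iff hπ h h').2 ⟨hg, y, hy'.symm, hg'⟩) (y := z)]
      rw [hz', ← hπ.add_of_eq hy'.symm]
      congr 1; ring
    · rw [indexFun_of_not_good hg', indexFun_of_not_good]
      intro hn
      obtain ⟨-, y', hy1, hy2⟩ := (good_comp_iff hπ h h').1 hn
      obtain rfl : y = y' := Option.some_injective _ (hy'.trans hy1)
      exact hg' hy2
  · rw [indexFun_of_not_good hg, indexMap_pt, indexFun_of_not_good]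
    exact fun hn => hg ((good_comp_iff hπ h h').1 hn).1

/-- Both sides move by the same time, so only the base point conditions matter. An orbit good for P,
P but not for P, Q hits `Q.snd` and ends there; conversely, avoiding the larger set `Q.snd` on [t,
3t] keeps the orbit in `P.diff`. -/
lemma indexMap_incl {P Q : TamePair π} {t : ℝ≥0} (h : P.Linked Q t) (h₁ : P.fst ⊆ Q.fst)
    (h₂ : P.snd ⊆ Q.snd) :
    indexMap hπ P P t (P.linked_self t) ≫ inclMap h₁ h₂ = indexMap hπ P Q t h := by
  refine hom_ext fun a ha => ?_
  rw [comp_map, indexMap_toQuot hπ _ ha, indexMap_toQuot hπ h ha]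
  by_cases hg : P.Good P t a
  · obtain ⟨y, hy, hy'⟩ := hg.2 _ le_self_add le_rfl
    rw [indexFun_of_good hg hy'.symm, inclMap_toQuot h₁ h₂ hy.1]
    by_cases hg' : P.Good Q t a
    · rw [indexFun_of_good hg' hy'.symm]
    · rw [indexFun_of_not_good hg']
      refine toQuot_eq_pt ?_
      by_contra hn
      refine hg' ⟨hg.1, fun s hs hs' => ?_⟩
      obtain ⟨z, hz, hz'⟩ := hg.2 s hs hs'
      rw [← hz', some_mem]
      refine ⟨h₁ hz.1, fun hzn => hn ?_⟩
      rw [← some_mem (A := Q.snd), hy']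
      refine Q.basic.mem_snd_of_hit hπ hs' (by rw [← hz']; exact some_mem.2 hzn)
        fun b hb hb' hm => notMem_of_mem_compl hm ?_
      exact mem_mono (fun _ hx => h₁ hx.1) (hg.2 b (hs.trans hb) hb')
  · rw [indexFun_of_not_good hg, indexFun_of_not_good]
    · exact (inclMap h₁ h₂).map_pt
    · rintro ⟨h3, h4⟩
      refine hg (good_self_iff.2 (P.basic.stays_diff ha.1 fun s hs => ?_))
      rcases le_total s t with hst | hst
      · exact mem_mono (fun _ hx => hx.2)
          (h3 s (hst.trans (le_mul_of_one_le_left zero_le one_le_two)))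
      · exact mem_mono (fun _ hx hx' => hx.2 (h₂ hx')) (h4 s hst hs)

/-- The morphism of the homotopy category given by the index maps. -/
noncomputable def canon (P Q : TamePair π) (h : ∃ T, P.Linked Q T) :
    (Quotient.functor PtdSpace.homotopic).obj (quotSpace P.fst P.snd) ⟶
      (Quotient.functor PtdSpace.homotopic).obj (quotSpace Q.fst Q.snd) :=
  (Quotient.functor _).map (indexMap hπ P Q h.choose h.choose_spec)

lemma canon_eq {P Q : TamePair π} {t : ℝ≥0} (h : P.Linked Q t) :
    canon hπ P Q ⟨t, h⟩ = (Quotient.functor _).map (indexMap hπ P Q t h) :=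
  CategoryTheory.Quotient.sound _ (homotopic_indexMap hπ P Q _ _)

lemma canon_self (P : TamePair π) (h : ∃ T, P.Linked P T) : canon hπ P P h = 𝟙 _ := by
  rw [canon_eq hπ (P.linked_self 0), indexMap_zero, CategoryTheory.Functor.map_id]

lemma canon_comp {P Q R : TamePair π} (h : ∃ T, P.Linked Q T) (h' : ∃ T, Q.Linked R T)
    (h'' : ∃ T, P.Linked R T) : canon hπ P Q h ≫ canon hπ Q R h' = canon hπ P R h'' := by
  obtain ⟨t, ht⟩ := h
  obtain ⟨t', ht'⟩ := h'
  obtain ⟨t'', ht''⟩ := h''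
  let T := t ⊔ t' ⊔ t''
  have h1 : P.Linked Q T := ht.mono (le_sup_left.trans le_sup_left)
  have h2 : Q.Linked R T := ht'.mono (le_sup_right.trans le_sup_left)
  have h3 : P.Linked R (2 * T) := ht''.mono
    (le_sup_right.trans (le_mul_of_one_le_left zero_le one_le_two))
  rw [canon_eq hπ h1, canon_eq hπ h2, canon_eq hπ h3, ← indexMap_comp hπ h1 h2, Functor.map_comp]

/-- The index map of P to itself is homotopic to the one at time 0, the identity, so in
`indexMap_incl` only the inclusion remains. -/
lemma canon_incl {P Q : TamePair π} (h : ∃ T, P.Linked Q T) (h₁ : P.fst ⊆ Q.fst)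
    (h₂ : P.snd ⊆ Q.snd) :
    canon hπ P Q h = (Quotient.functor _).map (inclMap h₁ h₂) := by
  obtain ⟨t, ht⟩ := h
  rw [canon_eq hπ ht, ← indexMap_incl hπ ht h₁ h₂, Functor.map_comp,
    ← canon_eq hπ, canon_self, Category.id_comp]

end TamePair

/-! ### Constructions with basic index pairs -/

namespace IsBasicIndexPair

variable {Z : Type w} [TopologicalSpace Z] {π : ℝ≥0 → Z → Option Z} {N₁ N₂ M₁ M₂ : Set Z}

/-- The intersection of two basic index pairs. -/
lemma inter (h : IsSemiflow π) (hN : IsBasicIndexPair π N₁ N₂) (hM : IsBasicIndexPair π M₁ M₂) :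
    IsBasicIndexPair π (N₁ ∩ M₁) (N₁ ∩ M₁ ∩ (N₂ ∪ M₂)) where
  subset := Set.inter_subset_left
  isClosed_fst := hN.isClosed_fst.inter hM.isClosed_fst
  isClosed_snd := (hN.isClosed_fst.inter hM.isClosed_fst).inter
    (hN.isClosed_snd.union hM.isClosed_snd)
  exit := by
    intro x hx t ht
    have hit : ∃ s ≤ t, π s x ∈ some '' (N₂ ∪ M₂) := by
      by_cases hN₁ : π t x ∈ some '' N₁
      · obtain ⟨s, hs, hs'⟩ := hM.exit x hx.2 t fun hM₁ => ht <| by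
          rw [Set.image_inter (Option.some_injective _)]; exact ⟨hN₁, hM₁⟩
        exact ⟨s, hs, mem_mono Set.subset_union_right hs'⟩
      · obtain ⟨s, hs, hs'⟩ := hN.exit x hx.1 t hN₁
        exact ⟨s, hs, mem_mono Set.subset_union_left hs'⟩
    obtain ⟨s, hs, hs'⟩ := hit
    -- At the first hit of N₂ ∪ M₂ the point is still in both first members, because leaving either
    -- of them requires an earlier hit.
    obtain ⟨a, ha, ha', hlt⟩ := h.exists_first (hN.isClosed_snd.union hM.isClosed_snd) hs'
    refine ⟨a, ha.trans hs, ?_⟩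
    obtain ⟨y, hy, hy'⟩ := ha'
    rw [← hy', some_mem]
    have key : ∀ {A B : Set Z}, IsBasicIndexPair π A B → B ⊆ N₂ ∪ M₂ → x ∈ A → y ∈ A := by
      intro A B hA hB hxA
      by_contra hn
      obtain ⟨b, hb, hb'⟩ := hA.exit x hxA a (by rwa [← hy', some_mem])
      rcases hb.lt_or_eq with hb1 | rfl
      · exact notMem_of_mem_compl (hlt b hb1) (mem_mono hB hb')
      · exact hn (hA.subset (by rwa [← hy', some_mem] at hb'))
    exact ⟨⟨key hN Set.subset_union_left hx.1, key hM Set.subset_union_right hx.2⟩, hy⟩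
  relInv := by
    intro x hx t ht
    by_contra! hn
    have key : ∀ {A B : Set Z}, IsBasicIndexPair π A B → N₁ ∩ M₁ ⊆ A → x ∈ B →
        π t x ∈ some '' B := fun hA hB hxB =>
      hA.mem_snd hxB fun s hs hm => hn s hs (mem_mono (Set.compl_subset_compl.2 hB) hm)
    have : π t x ∈ some '' (N₂ ∪ M₂) := hx.2.elim
      (fun hx' => mem_mono Set.subset_union_left (key hN Set.inter_subset_left hx'))
      (fun hx' => mem_mono Set.subset_union_right (key hM Set.inter_subset_right hx'))
    obtain ⟨y, hy, hy'⟩ := this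
    refine hn t le_rfl ?_
    rw [← hy', some_mem] at ht ⊢
    exact fun hm => ht ⟨hm, hy⟩

/-- The exit set may be enlarged by the points that reach it within time `T`. -/
lemma expand (h : IsSemiflow π) (hN : IsBasicIndexPair π N₁ N₂) (T : ℝ≥0) :
    IsBasicIndexPair π N₁ {x ∈ N₁ | ¬ Stays π N₂ᶜ T x} where
  subset := Set.sep_subset _ _
  isClosed_fst := hN.isClosed_fst
  isClosed_snd := hN.isClosed_fst.inter
    (h.isOpen_stays_time hN.isClosed_snd.isOpen_compl T).isClosed_compl
  exit := by
    intro x hx t ht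
    obtain ⟨s, hs, hs'⟩ := hN.exit x hx t ht
    refine ⟨s, hs, mem_mono (B := {x ∈ N₁ | ¬ Stays π N₂ᶜ T x})
      (fun y hy => ⟨hN.subset hy, fun hn => ?_⟩) hs'⟩
    exact h.stays_mem hn hy
  relInv := by
    rintro x ⟨hx, hx'⟩ t ht
    by_contra! hn
    obtain ⟨s, hs, hs'⟩ := hN.exists_hit hx hx'
    -- Either N₂ is still ahead, at distance s - t ≤ T, or it has been entered and not left.
    rcases le_total t s with hts | hts
    · obtain ⟨y, hy⟩ := Option.isSome_iff_exists.1 (h.isSome_of_le hts (isSome_of_mem hs'))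
      rw [hy, some_mem] at ht
      have hyN : y ∈ N₁ := by
        have := hn t le_rfl
        rw [hy, some_mem] at this
        by_contra hy'
        exact this hy'
      refine ht ⟨hyN, fun hst => ?_⟩
      have := hst (s - t) (tsub_le_self.trans hs)
      rw [← h.sub_of_eq hts hy] at this
      exact notMem_of_mem_compl this hs'
    · obtain ⟨y, hy, hy'⟩ := hN.mem_snd_of_hit h hts hs' fun a _ ha => hn a ha
      rw [← hy', some_mem] at ht
      exact ht ⟨hN.subset hy, fun hst => h.stays_mem hst hy⟩

/-- The first member may be replaced by the closure of the difference. -/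
lemma core (h : IsSemiflow π) (hN : IsBasicIndexPair π N₁ N₂) :
    IsBasicIndexPair π (closure (N₁ \ N₂)) (closure (N₁ \ N₂) ∩ N₂) where
  subset := Set.inter_subset_left
  isClosed_fst := isClosed_closure
  isClosed_snd := isClosed_closure.inter hN.isClosed_snd
  exit := by
    intro x hx t ht
    have hxN : x ∈ N₁ := closure_minimal Set.sdiff_subset hN.isClosed_fst hx
    have hns : ¬ Stays π N₂ᶜ t x := fun hs =>
      ht (mem_mono subset_closure (hN.stays_diff hxN hs t le_rfl))
    obtain ⟨s, hs, hs'⟩ := hN.exists_hit hxN hns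
    -- Before the first hit of N₂ the orbit lies in N₁ \ N₂, so the hitting point belongs to the
    -- closure.
    obtain ⟨a, ha, ha', hlt⟩ := h.exists_first hN.isClosed_snd hs'
    refine ⟨a, ha.trans hs, ?_⟩
    obtain ⟨y, hy, hy'⟩ := ha'
    rw [← hy', some_mem]
    refine ⟨?_, hy⟩
    rw [← some_mem (A := closure (N₁ \ N₂)), hy']
    refine h.mem_of_forall_lt isClosed_closure hx (fun b hb => ?_) (by rw [← hy']; rfl)
    have := hN.stays_diff hxN (t := b) fun c hc => hlt c (hc.trans_lt hb)
    exact mem_mono subset_closure (this b le_rfl)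
  relInv := by
    rintro x ⟨hx, hx'⟩ t ht
    by_contra! hn
    have hsub : closure (N₁ \ N₂) ⊆ N₁ := closure_minimal Set.sdiff_subset hN.isClosed_fst
    obtain ⟨y, hy, hy'⟩ := hN.mem_snd hx' fun s hs hm =>
      hn s hs (mem_mono (Set.compl_subset_compl.2 hsub) hm)
    refine hn t le_rfl ?_
    rw [← hy', some_mem] at ht ⊢
    exact fun hm => ht ⟨hm, hy⟩

end IsBasicIndexPair

namespace SkewProductSemiflow

/-! ### Relating the semiflows on `ℝ⁺ × X` and on `Y × X` -/

section Topological

variable {Y : Type v} {X : Type u} [TopologicalSpace Y] [TopologicalSpace X]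
  (σ : SkewProductSemiflow Y X) (y₀ : Y)

lemma isSemiflow_flow : IsSemiflow σ.flow := σ.isSemiflow

lemma continuous_trans : Continuous fun t : ℝ≥0 => σ.trans t y₀ :=
  σ.trans.continuous continuous_id continuous_const

lemma continuous_r : Continuous (σ.r y₀) :=
  ((σ.continuous_trans y₀).comp continuous_fst).prodMk continuous_snd

lemma r_mem_hullProd (p : ℝ≥0 × X) : σ.r y₀ p ∈ σ.hullProd y₀ :=
  ⟨subset_closure ⟨p.1, rfl⟩, trivial⟩

lemma isClosed_hullProd : IsClosed (σ.hullProd y₀) := isClosed_closure.prod isClosed_univ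

lemma trans_add (s t : ℝ≥0) : σ.trans (t + s) y₀ = σ.trans s (σ.trans t y₀) := by
  rw [add_comm]; exact σ.trans.map_add s t y₀

lemma map_r_chi (s : ℝ≥0) (p : ℝ≥0 × X) :
    (σ.chi y₀ s p).map (σ.r y₀) = σ.flow s (σ.r y₀ p) := by
  simp only [chi, flow, r, Option.map_map]
  congr 1
  funext x
  exact Prod.ext (σ.trans_add y₀ s p.1) rfl

lemma map_snd_flow (s : ℝ≥0) (z : Y × X) : (σ.flow s z).map Prod.snd = σ.Φ s z.1 z.2 := by
  simp only [flow, Option.map_map]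
  exact Option.map_id'

variable {y₀ : Y}

lemma chi_mem {s : ℝ≥0} {p : ℝ≥0 × X} {A : Set (Y × X)} :
    σ.chi y₀ s p ∈ some '' (σ.r y₀ ⁻¹' A) ↔ σ.flow s (σ.r y₀ p) ∈ some '' A := by
  rw [← map_r_chi]
  cases σ.chi y₀ s p <;> simp

lemma isSome_chi {s : ℝ≥0} {p : ℝ≥0 × X} :
    (σ.chi y₀ s p).isSome ↔ (σ.flow s (σ.r y₀ p)).isSome := by
  simp [← map_r_chi]

lemma stays_chi {t : ℝ≥0} {p : ℝ≥0 × X} {A : Set (Y × X)} :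
    Stays (σ.chi y₀) (σ.r y₀ ⁻¹' A) t p ↔ Stays σ.flow A t (σ.r y₀ p) :=
  forall₂_congr fun _ _ => σ.chi_mem

lemma noBlowUp_chi {A : Set (Y × X)} (h : NoBlowUp σ.flow A) :
    NoBlowUp (σ.chi y₀) (σ.r y₀ ⁻¹' A) := fun _ _ hb H =>
  σ.isSome_chi.2 (h _ _ hb fun s hs => σ.chi_mem.1 (H s hs))

/-- Domain and X component are inherited from `σ.flow` along `r`; the time component is treated
separately, since `r` need not be injective. -/
lemma isSemiflow_chi : IsSemiflow (σ.chi y₀) where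
  isOpen_dom := by
    have hc : Continuous fun p : ℝ≥0 × (ℝ≥0 × X) => (p.1, σ.r y₀ p.2) :=
      continuous_fst.prodMk ((σ.continuous_r y₀).comp continuous_snd)
    convert σ.isSemiflow_flow.isOpen_dom.preimage hc using 1
    ext p
    exact σ.isSome_chi
  continuous := by
    have hc : Continuous fun p : {p : ℝ≥0 × (ℝ≥0 × X) // (σ.chi y₀ p.1 p.2).isSome} =>
        (⟨(p.1.1, σ.r y₀ p.1.2), σ.isSome_chi.1 p.2⟩ :
          {p : ℝ≥0 × (Y × X) // (σ.flow p.1 p.2).isSome}) :=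
      ((continuous_fst.comp continuous_subtype_val).prodMk ((σ.continuous_r y₀).comp
        (continuous_snd.comp continuous_subtype_val))).subtype_mk _
    have h1 : Continuous fun p : {p : ℝ≥0 × (ℝ≥0 × X) // (σ.chi y₀ p.1 p.2).isSome} =>
        p.1.2.1 + p.1.1 := by fun_prop
    refine (h1.prodMk (continuous_snd.comp
      (σ.isSemiflow_flow.continuous.comp hc))).congr fun p => ?_
    obtain ⟨⟨s, t, x⟩, hp⟩ := p
    simp [chi, flow, r]
  zero := by
    rintro ⟨t, x⟩
    have := σ.map_snd_flow 0 (σ.trans t y₀, x)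
    rw [σ.isSemiflow_flow.zero] at this
    rw [chi, ← this]
    simp
  add s t p := by
    have h := σ.map_snd_flow (s + t) (σ.trans p.1 y₀, p.2)
    rw [σ.isSemiflow_flow.add] at h
    simp only [chi]
    rw [← h]
    simp only [flow]
    cases σ.Φ t (σ.trans p.1 y₀) p.2 with
    | none => rfl
    | some x =>
      change _ = (σ.Φ s (σ.trans (p.1 + t) y₀) x).map _
      rw [trans_add, ← σ.map_snd_flow s (_, x)]
      simp only [Option.map_some, Option.bind_some, Option.map_map]
      congr 1
      funext z
      simp [add_comm, add_left_comm]

lemma mem_hullProd_of_flow {s : ℝ≥0} {z z' : Y × X} (hz : z ∈ σ.hullProd y₀)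
    (h : σ.flow s z = some z') : z' ∈ σ.hullProd y₀ := by
  have h1 : z'.1 = σ.trans s z.1 := by
    simp only [flow, Option.map_eq_some_iff] at h
    obtain ⟨x, -, rfl⟩ := h
    rfl
  refine ⟨?_, trivial⟩
  rw [h1]
  refine map_mem_closure (σ.trans.continuous continuous_const continuous_id) hz.1 ?_
  rintro _ ⟨t, rfl⟩
  exact ⟨s + t, σ.trans.map_add s t y₀⟩

lemma exists_isOpen_of_subset_relInterior {Z : Type w} [TopologicalSpace Z] {A K W : Set Z}
    (h : K ⊆ relInterior A W) : ∃ O, IsOpen O ∧ K ⊆ O ∧ O ∩ A ⊆ W := by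
  refine ⟨interior {z | z ∈ A → z ∈ W}, isOpen_interior, fun k hk => ?_,
    fun z hz => interior_subset hz.1 hz.2⟩
  exact mem_interior_iff_mem_nhds.2 (mem_nhdsWithin_iff_eventually.1 (h hk).2)

lemma subset_relInterior {Z : Type w} [TopologicalSpace Z] {A K O : Set Z} (hK : K ⊆ A)
    (hO : IsOpen O) (hKO : K ⊆ O) : K ⊆ relInterior A (O ∩ A) := fun _ hk =>
  ⟨hK hk, Filter.inter_mem (mem_nhdsWithin_of_mem_nhds (hO.mem_nhds (hKO hk)))
    self_mem_nhdsWithin⟩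

/-! ### Index pairs -/

namespace IsIndexPair

variable {σ} {K : Set (Y × X)} {N₁ N₂ M₁ M₂ : Set (ℝ≥0 × X)}

/-- As `r` takes values in the hull, the relative neighborhood may be traded for an open set of Y ×
X. -/
lemma exists_isOpen (hN : σ.IsIndexPair y₀ K N₁ N₂) :
    ∃ O, IsOpen O ∧ K ⊆ O ∧ σ.r y₀ ⁻¹' O ⊆ N₁ \ N₂ := by
  obtain ⟨W, -, hKW, hW⟩ := hN.inner
  obtain ⟨O, hO, hKO, hOW⟩ := exists_isOpen_of_subset_relInterior hKW
  exact ⟨O, hO, hKO, fun p hp => hW (hOW ⟨hp, σ.r_mem_hullProd y₀ p⟩)⟩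

lemma subset_hullProd (hN : σ.IsIndexPair y₀ K N₁ N₂) : K ⊆ σ.hullProd y₀ := by
  obtain ⟨N, hN, -⟩ := hN.outer
  rw [hN.inv_eq]
  exact (inv_subset N).trans hN.subset

lemma stays (hN : σ.IsIndexPair y₀ K N₁ N₂) (t : ℝ≥0) {k : Y × X} (hk : k ∈ K) :
    Stays σ.flow K t k := by
  obtain ⟨N, hN, -⟩ := hN.outer
  rw [hN.inv_eq] at hk ⊢
  exact stays_of_mem_inv hk t

lemma inner_of_isOpen (hN : σ.IsIndexPair y₀ K N₁ N₂) {O : Set (Y × X)} (hO : IsOpen O)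
    (hKO : K ⊆ O) (h : σ.r y₀ ⁻¹' O ⊆ M₁ \ M₂) :
    ∃ W, W ⊆ σ.hullProd y₀ ∧ K ⊆ relInterior (σ.hullProd y₀) W ∧
      σ.r y₀ ⁻¹' W ⊆ M₁ \ M₂ :=
  ⟨O ∩ σ.hullProd y₀, Set.inter_subset_right, subset_relInterior hN.subset_hullProd hO hKO,
    fun _ hp => h hp.1⟩

lemma inter (hN : σ.IsIndexPair y₀ K N₁ N₂) (hM : σ.IsIndexPair y₀ K M₁ M₂) :
    σ.IsIndexPair y₀ K (N₁ ∩ M₁) (N₁ ∩ M₁ ∩ (N₂ ∪ M₂)) where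
  basic := hN.basic.inter σ.isSemiflow_chi hM.basic
  outer := by
    obtain ⟨N, h1, h2, h3⟩ := hN.outer
    exact ⟨N, h1, h2, fun p hp => h3 ⟨hp.1.1, fun h => hp.2 ⟨hp.1, Or.inl h⟩⟩⟩
  inner := by
    obtain ⟨O, hO, hKO, h⟩ := hN.exists_isOpen
    obtain ⟨O', hO', hKO', h'⟩ := hM.exists_isOpen
    refine hN.inner_of_isOpen (hO.inter hO') (Set.subset_inter hKO hKO') fun p hp => ?_
    have h1 := h hp.1
    have h2 := h' hp.2
    exact ⟨⟨h1.1, h2.1⟩, fun hn => hn.2.elim h1.2 h2.2⟩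

/-- By invariance of K, the points whose orbits stay in O up to time T form an open neighborhood of
K, and over it N₂ is not reached by time T. -/
lemma expand (hN : σ.IsIndexPair y₀ K N₁ N₂) (T : ℝ≥0) :
    σ.IsIndexPair y₀ K N₁ {x ∈ N₁ | ¬ Stays (σ.chi y₀) N₂ᶜ T x} where
  basic := hN.basic.expand σ.isSemiflow_chi T
  outer := by
    obtain ⟨N, h1, h2, h3⟩ := hN.outer
    refine ⟨N, h1, h2, fun p hp => h3 ⟨hp.1, fun h => hp.2 ⟨hp.1, fun hs => ?_⟩⟩⟩
    exact σ.isSemiflow_chi.stays_mem hs h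
  inner := by
    obtain ⟨O, hO, hKO, h⟩ := hN.exists_isOpen
    refine hN.inner_of_isOpen (σ.isSemiflow_flow.isOpen_stays_time hO T)
      (fun k hk => (hN.stays T hk).mono hKO le_rfl) fun p hp => ?_
    have hs : Stays (σ.chi y₀) (N₁ \ N₂) T p := (σ.stays_chi.2 hp).mono h le_rfl
    exact ⟨(σ.isSemiflow_chi.stays_mem hs).1, fun hn => hn.2 (hs.mono (fun _ => And.right) le_rfl)⟩

lemma core (hN : σ.IsIndexPair y₀ K N₁ N₂) :
    σ.IsIndexPair y₀ K (closure (N₁ \ N₂)) (closure (N₁ \ N₂) ∩ N₂) where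
  basic := hN.basic.core σ.isSemiflow_chi
  outer := by
    obtain ⟨N, h1, h2, h3⟩ := hN.outer
    refine ⟨N, h1, h2, fun p hp => h3 ⟨?_, fun h => hp.2 ⟨hp.1, h⟩⟩⟩
    exact closure_minimal Set.sdiff_subset hN.basic.isClosed_fst hp.1
  inner := by
    obtain ⟨W, h1, h2, h3⟩ := hN.inner
    exact ⟨W, h1, h2, fun p hp => ⟨subset_closure (h3 hp), fun h => (h3 hp).2 h.2⟩⟩

end IsIndexPair

end Topological

/-! ### Links and zigzags between index pairs -/

section Metric

variable {Y : Type v} {X : Type u} [MetricSpace Y] [MetricSpace X]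
  {σ : SkewProductSemiflow Y X} {y₀ : Y} {K : Set (Y × X)}

namespace IsIndexPair

variable {N₁ N₂ M₁ M₂ A₁ A₂ : Set (ℝ≥0 × X)}

/-- The pair of an index pair, as a tame pair. -/
def toTame (hN : σ.IsIndexPair y₀ K N₁ N₂) : TamePair (σ.chi y₀) where
  fst := N₁
  snd := N₂
  basic := hN.basic
  tame := by
    obtain ⟨N, h1, h2, h3⟩ := hN.outer
    exact ⟨_, h1.isClosed.preimage (σ.continuous_r y₀),
      σ.noBlowUp_chi (h2.noBlowUp σ.isSemiflow_flow), h3⟩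

lemma exists_stays_imp (hN : σ.IsIndexPair y₀ K N₁ N₂) (hM : σ.IsIndexPair y₀ K M₁ M₂) :
    ∃ T, ∀ t ≥ T, ∀ x, Stays (σ.chi y₀) (N₁ \ N₂) (2 * t) x →
      σ.chi y₀ t x ∈ some '' (M₁ \ M₂) := by
  obtain ⟨N, h1, h2, h3⟩ := hN.outer
  obtain ⟨O, hO, hKO, h⟩ := hM.exists_isOpen
  obtain ⟨T, hT⟩ := exists_stays_imp_mem σ.isSemiflow_flow h1.isClosed h2 hO (h1.inv_eq ▸ hKO)
  exact ⟨T, fun t ht x hx =>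
    mem_mono h (σ.chi_mem.2 (hT t ht _ (σ.stays_chi.1 (hx.mono h3 le_rfl))))⟩

lemma exists_linked (hN : σ.IsIndexPair y₀ K N₁ N₂) (hM : σ.IsIndexPair y₀ K M₁ M₂) :
    ∃ T, hN.toTame.Linked hM.toTame T := by
  obtain ⟨T, hT⟩ := hN.exists_stays_imp hM
  obtain ⟨T', hT'⟩ := hM.exists_stays_imp hN
  exact ⟨max T T', fun t ht x => ⟨hT t (le_of_max_le_left ht) x, hT' t (le_of_max_le_right ht) x⟩⟩

/-- Points of a smaller index pair that leave it at a late time leave the larger one soon after. -/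
lemma exists_core_subset_expand (hA : σ.IsIndexPair y₀ K A₁ A₂)
    (hN : σ.IsIndexPair y₀ K N₁ N₂) (hAN : A₁ ⊆ N₁) :
    ∃ T₀, ∀ T ≥ T₀, closure (A₁ \ {x ∈ A₁ | ¬ Stays (σ.chi y₀) A₂ᶜ T x}) ∩
      {x ∈ A₁ | ¬ Stays (σ.chi y₀) A₂ᶜ T x} ⊆
        {x ∈ N₁ | ¬ Stays (σ.chi y₀) N₂ᶜ (2 * T) x} := by
  have hπ := σ.isSemiflow_chi (y₀ := y₀)
  obtain ⟨T₀, hT₀⟩ := hN.exists_stays_imp hA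
  refine ⟨T₀, fun T hT x hx => ⟨hAN hx.2.1, fun hs => ?_⟩⟩
  have hsN := hN.basic.stays_diff (hAN hx.2.1) hs
  have hTT : T ≤ 2 * T := le_mul_of_one_le_left zero_le one_le_two
  -- The middle point at time T lies in A₁ \ A₂. But A₂ was hit by then, and x, a limit of points
  -- staying in A₁ up to T, cannot have left A₁ meanwhile, so the point at time T is also in A₂.
  have hxT := hT₀ T hT x hsN
  obtain ⟨s, hsT, hs'⟩ := hA.basic.exists_hit hx.2.1 hx.2.2
  have hcl : (T, x) ∈ closure {p : ℝ≥0 × (ℝ≥0 × X) | Stays (σ.chi y₀) A₁ p.1 p.2} := by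
    refine map_mem_closure (Continuous.prodMk_right T) hx.1 fun y hy => ?_
    have : Stays (σ.chi y₀) A₂ᶜ T y := by
      by_contra hn; exact hy.2 ⟨hy.1, hn⟩
    exact (hA.basic.stays_diff hy.1 this).mono Set.sdiff_subset le_rfl
  have hA₂ := hA.basic.mem_snd_of_hit hπ hsT hs' fun a _ ha hm => notMem_of_mem_compl hm
    (hπ.mem_of_mem_closure_stays hA.basic.isClosed_fst hcl ha
      (isSome_of_mem (hsN a (ha.trans hTT))))
  exact notMem_of_mem_compl (mem_mono (fun _ => And.right) hxT) hA₂

/-- Any two index pairs are connected by inclusions of index pairs. -/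
lemma exists_zigzag (hN : σ.IsIndexPair y₀ K N₁ N₂) (hM : σ.IsIndexPair y₀ K M₁ M₂) :
    ∃ (T : ℝ≥0) (R₁ R₂ : Set (ℝ≥0 × X)), σ.IsIndexPair y₀ K R₁ R₂ ∧ R₁ ⊆ N₁ ∧ R₁ ⊆ M₁ ∧
      R₂ ⊆ {x ∈ N₁ | ¬ Stays (σ.chi y₀) N₂ᶜ T x} ∧
      R₂ ⊆ {x ∈ M₁ | ¬ Stays (σ.chi y₀) M₂ᶜ T x} := by
  have hA := hN.inter hM
  obtain ⟨T, hT⟩ := hA.exists_core_subset_expand hN Set.inter_subset_left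
  obtain ⟨T', hT'⟩ := hA.exists_core_subset_expand hM Set.inter_subset_right
  have hsub := closure_minimal (s := (N₁ ∩ M₁) \
    {x ∈ N₁ ∩ M₁ | ¬ Stays (σ.chi y₀) (N₁ ∩ M₁ ∩ (N₂ ∪ M₂))ᶜ (max T T') x})
    Set.sdiff_subset hA.basic.isClosed_fst
  -- R is the core of the intersection with expanded exit set; the factor 2 is that of
  -- `exists_core_subset_expand`.
  exact ⟨2 * max T T', _, _, (hA.expand (max T T')).core, hsub.trans Set.inter_subset_left,
    hsub.trans Set.inter_subset_right, hT _ (le_max_left _ _), hT' _ (le_max_right _ _)⟩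

end IsIndexPair

end Metric

end SkewProductSemiflow

/-! ### Existence of index pairs -/

section Existence

open Filter

lemma isClosed_inv {Z : Type w} [MetricSpace Z] {π : ℝ≥0 → Z → Option Z} (h : IsSemiflow π)
    {N : Set Z} (hN : IsClosed N) (hN' : StronglyAdmissible π N) : IsClosed (inv π N) := by
  refine IsSeqClosed.isClosed fun x z hx hz => ?_
  obtain ⟨y, hy, k, hk, hk'⟩ := exists_subseq_inv h hN hN' hx
  rwa [tendsto_nhds_unique (hz.comp hk.tendsto_atTop) hk']

/-- The points that are reached from a `δ`-neighborhood of `K` through orbits in `V`. -/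
def reach {Z : Type w} [MetricSpace Z] (π : ℝ≥0 → Z → Option Z) (K V : Set Z) (δ : ℝ) : Set Z :=
  {w | ∃ t, ∃ z ∈ Metric.thickening δ K, Stays π V t z ∧ π t z = some w}

variable {Z : Type w} [MetricSpace Z] {π : ℝ≥0 → Z → Option Z} (h : IsSemiflow π)
  {H N : Set Z} (hH : IsClosed H) (hHπ : ∀ z ∈ H, ∀ s w, π s z = some w → w ∈ H)
  (hN : IsClosed N) (hN' : StronglyAdmissible π N) {ρ : Z → ℝ} (hρ : Continuous ρ)
  (hρN : ∀ z ∈ H, ρ z < 1 → z ∈ N) (hρK : ∀ z ∈ inv π N, ρ z = 0)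

lemma reach_subset {K V : Set Z} {δ : ℝ} : reach π K V δ ⊆ V := by
  rintro w ⟨t, z, -, hst, hw⟩
  simpa [hw] using hst t le_rfl

include h hHπ hρ in
-- An orbit that reaches a point can be prolonged while ρ < 1/2. This is an open condition, so it
-- carries over to the closure.
lemma mem_closure_reach {δ : ℝ} {t : ℝ≥0} {x : Z}
    (hx : x ∈ closure (reach π (inv π N) {z ∈ H | ρ z ≤ 1 / 2} δ))
    (ht : Stays π {z | ρ z < 1 / 2} t x) :
    π t x ∈ some '' closure (reach π (inv π N) {z ∈ H | ρ z ≤ 1 / 2} δ) := by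
  by_contra hn
  have hO : IsOpen {y | ρ y < 1 / 2} := isOpen_lt hρ continuous_const
  have ho := ((h.isOpen_mem (isClosed_closure
    (s := reach π (inv π N) {z ∈ H | ρ z ≤ 1 / 2} δ)).isOpen_compl).preimage
      (Continuous.prodMk_right t)).inter (h.isOpen_stays_time hO t)
  obtain ⟨y, ⟨hy1, hy2⟩, τ, z, hz, hst, hw⟩ := mem_closure_iff.1 hx _ ho
    ⟨mem_compl_of_isSome (isSome_of_mem (ht t le_rfl)) hn, ht⟩
  obtain ⟨q, hq, hyq⟩ := hy1
  refine hq (subset_closure ⟨t + τ, z, hz, fun s hs => ?_, by rw [h.add_of_eq hw]; exact hyq.symm⟩)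
  rcases le_total s τ with hsτ | hsτ
  · exact hst s hsτ
  · obtain ⟨p, hp, hp'⟩ := hy2 (s - τ) (tsub_le_iff_right.2 hs)
    rw [← h.sub_of_eq hsτ hw] at hp'
    rw [← hp', some_mem]
    exact ⟨hHπ z (h.stays_mem hst).1 _ _ hp'.symm, le_of_lt hp⟩

include h hN hN' hρ hρN hρK in
/-- Points reached from a small neighborhood of the invariant set that are not close to this set
leave the isolating neighborhood within bounded time. -/
lemma exists_reach_not_stays :
    ∃ δ > 0, ∃ T : ℝ≥0, ∀ x ∈ closure (reach π (inv π N) {z ∈ H | ρ z ≤ 1 / 2} δ),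
      1 / 4 ≤ ρ x → ¬ Stays π N T x := by
  -- A sequence of counterexamples, with δ → 0 and T → ∞, accumulates at a point of the invariant
  -- set where nevertheless ρ ≥ 1/4.
  by_contra! hn
  have hpos : ∀ n : ℕ, (0 : ℝ) < 1 / (n + 1) := fun n => by positivity
  have hlim0 := tendsto_one_div_add_atTop_nhds_zero_nat (𝕜 := ℝ)
  choose x hx hxρ hxN using fun n : ℕ => hn (1 / (n + 1)) (hpos n) (n : ℝ≥0)
  choose w hw hxw using fun n : ℕ => Metric.mem_closure_iff.1 (hx n) _ (hpos n)
  choose t z hz hst htw using hw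
  choose k hkK hzk using fun n => Metric.mem_thickening_iff.1 (hz n)
  have hstN : ∀ n, Stays π N (t n) (z n) := fun n => (hst n).mono
    (fun y hy => hρN y hy.1 (by linarith [hy.2])) le_rfl
  obtain ⟨k', hk', a, ha, hka⟩ := exists_subseq_inv h hN hN' hkK
  obtain ⟨w', b, hb, hwb⟩ := hN'.exists_subseq h (z := z ∘ a) (t := t ∘ a) (w := w ∘ a)
    (fun n => hstN (a n)) (fun n => htw (a n))
  let c := a ∘ b
  have hc : Tendsto c atTop atTop := (ha.comp hb).tendsto_atTop
  have hkc : Tendsto (k ∘ c) atTop (𝓝 k') := hka.comp hb.tendsto_atTop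
  have hwc : Tendsto (w ∘ c) atTop (𝓝 w') := hwb
  have dist_lim : ∀ {f g : ℕ → Z} {y : Z}, (∀ n, dist (f n) (g n) < 1 / (n + 1)) →
      Tendsto (g ∘ c) atTop (𝓝 y) → Tendsto (f ∘ c) atTop (𝓝 y) := fun {f g y} hfg hg => by
    refine (tendsto_iff_of_dist ?_).2 hg
    exact squeeze_zero (fun _ => dist_nonneg) (fun n => (hfg (c n)).le) (hlim0.comp hc)
  have hzc : Tendsto (z ∘ c) atTop (𝓝 k') := dist_lim hzk hkc
  have hxc : Tendsto (x ∘ c) atTop (𝓝 w') := dist_lim hxw hwc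
  have hρw : 1 / 4 ≤ ρ w' := ge_of_tendsto (hρ.continuousAt.tendsto.comp hxc)
    (Eventually.of_forall fun n => hxρ (c n))
  -- The starting points approach the invariant set, so up to any fixed time their orbits keep ρ <
  -- 1/8 eventually, whereas ρ ≥ 1/4 at the limit of the end points.
  have htc : Tendsto (t ∘ c) atTop atTop := by
    refine tendsto_atTop.2 fun C => ?_
    have hO : IsOpen {y | ρ y < 1 / 8} := isOpen_lt hρ continuous_const
    have h1 := hzc.eventually ((h.isOpen_stays_time hO C).mem_nhds
      ((stays_of_mem_inv hk' C).mono (fun y hy => by simp [hρK y hy]) le_rfl))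
    have h2 := (hρ.continuousAt.tendsto.comp hwc).eventually_const_lt
      (show (1 / 8 : ℝ) < ρ w' by linarith)
    filter_upwards [h1, h2] with n hn1 hn2
    by_contra! hlt
    have := hn1 _ hlt.le
    simp only [Function.comp_apply, htw, some_mem] at this hn2
    exact absurd this (not_lt.2 hn2.le)
  have hw'K : w' ∈ inv π N := by
    refine mem_inv_of_tendsto_of_stays h hN hN' htc (fun n => hstN (c n)) (fun n => htw (c n)) hwc
      fun a => stays_of_tendsto h hN hN' ?_ hxc
    filter_upwards [(tendsto_natCast_atTop_atTop (R := ℝ≥0)).comp hc |>.eventually_ge_atTop a]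
      with n hn
    exact (hxN (c n)).mono subset_rfl hn
  rw [hρK _ hw'K] at hρw
  norm_num at hρw

include h hH hHπ hN' hρ hρN in
-- The closed reachable set can only be left through ρ ≥ 1/2. There `hT` forces the orbit out of N,
-- hence out of ρ < 3/4, within time T, so the exit set is hit. Conversely ρ ≤ 1/2 on the reachable
-- set, so a point of the exit set cannot reach level 3/4 before leaving, and this makes the exit
-- set relatively invariant.
lemma isBasicIndexPair_reach {δ : ℝ} {T : ℝ≥0}
    (hT : ∀ x ∈ closure (reach π (inv π N) {z ∈ H | ρ z ≤ 1 / 2} δ),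
      1 / 4 ≤ ρ x → ¬ Stays π N T x) :
    IsBasicIndexPair π (closure (reach π (inv π N) {z ∈ H | ρ z ≤ 1 / 2} δ))
      {x ∈ closure (reach π (inv π N) {z ∈ H | ρ z ≤ 1 / 2} δ) |
        ¬ Stays π {z | ρ z < 3 / 4} T x} := by
  set B := closure (reach π (inv π N) {z ∈ H | ρ z ≤ 1 / 2} δ)
  have hV : IsClosed {z ∈ H | ρ z ≤ 1 / 2} := hH.inter (isClosed_le hρ continuous_const)
  have hBV : B ⊆ {z ∈ H | ρ z ≤ 1 / 2} := closure_minimal reach_subset hV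
  have hBN : B ⊆ N := fun z hz => hρN z (hBV hz).1 (by linarith [(hBV hz).2])
  have hU : IsOpen {z | ρ z < 3 / 4} := isOpen_lt hρ continuous_const
  refine ⟨Set.sep_subset _ _, isClosed_closure,
    isClosed_closure.inter (h.isOpen_stays_time hU T).isClosed_compl, fun x hx t ht => ?_,
    fun x hx t ht => ?_⟩
  · have hit : ∃ s ≤ t, π s x ∈ some '' {z | 1 / 2 ≤ ρ z} := by
      by_contra! hn
      have key : ∀ s ≤ t, (π s x).isSome → π s x ∈ some '' B := fun s hs hd =>
        mem_closure_reach h hHπ hρ hx fun a ha =>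
          mem_mono (fun z (hz : ¬ 1 / 2 ≤ ρ z) => not_le.1 hz) (mem_compl_of_isSome (h.isSome_of_le ha hd)
            (hn a (ha.trans hs)))
      exact ht (key t le_rfl (h.isSome_of_noBlowUp (hN'.noBlowUp h)
        fun s hs hd => mem_mono hBN (key s hs hd)))
    obtain ⟨s, hs, hs'⟩ := hit
    obtain ⟨a, ha, ha', hlt⟩ := h.exists_first (isClosed_le continuous_const hρ) hs'
    have haB : π a x ∈ some '' B := h.mem_of_forall_lt isClosed_closure hx
      (fun b hb => mem_closure_reach h hHπ hρ hx fun c hc =>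
        mem_mono (fun z (hz : ¬ 1 / 2 ≤ ρ z) => not_le.1 hz) (hlt c (hc.trans_lt hb))) (isSome_of_mem ha')
    obtain ⟨y, hy, hy'⟩ := haB
    refine ⟨a, ha.trans hs, ?_⟩
    rw [← hy', some_mem] at ha' ⊢
    refine ⟨hy, fun hst => hT y hy ?_ fun b hb => ?_⟩
    · exact le_trans (by norm_num) (Set.mem_ofPred_eq ▸ ha')
    · obtain ⟨q, hq, hq'⟩ := hst b hb
      rw [← hq', some_mem]
      exact hρN q (hHπ y (hBV hy).1 _ _ hq'.symm) (lt_trans hq (by norm_num))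
  · by_contra! hn
    have key : ∀ s ≤ t, (π s x).isSome → π s x ∈ some '' B := fun s hs hd => by
      by_contra hB
      exact hn s hs (mem_compl_of_isSome hd hB)
    have hd := h.isSome_of_noBlowUp (hN'.noBlowUp h)
      fun s hs hd => mem_mono hBN (key s hs hd)
    obtain ⟨y, hy, hy'⟩ := key t le_rfl hd
    rw [← hy', some_mem] at ht
    refine ht ⟨hy, fun hst => hx.2 fun s hs => ?_⟩
    rcases le_total s t with hst' | hst'
    · exact mem_mono (fun z hz => lt_of_le_of_lt (hBV hz).2 (by norm_num))
        (key s hst' (h.isSome_of_le hst' hd))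
    · rw [h.sub_of_eq hst' hy'.symm]
      exact hst _ (tsub_le_self.trans hs)

end Existence

namespace SkewProductSemiflow

lemma isBasicIndexPair_preimage_r {Y : Type v} {X : Type u} [TopologicalSpace Y]
    [TopologicalSpace X] {σ : SkewProductSemiflow Y X} {N₁ N₂ : Set (Y × X)}
    (hN : IsBasicIndexPair σ.flow N₁ N₂) (y₀ : Y) :
    IsBasicIndexPair (σ.chi y₀) (σ.r y₀ ⁻¹' N₁) (σ.r y₀ ⁻¹' N₂) where
  subset := Set.preimage_mono hN.subset
  isClosed_fst := hN.isClosed_fst.preimage (σ.continuous_r y₀)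
  isClosed_snd := hN.isClosed_snd.preimage (σ.continuous_r y₀)
  exit p hp t ht := by
    simp only [σ.chi_mem] at ht ⊢
    exact hN.exit _ hp t ht
  relInv p hp t ht := by
    rw [← Set.preimage_compl]
    simp only [σ.chi_mem] at ht ⊢
    exact hN.relInv _ hp t ht

/-- Here ρ is a Urysohn function, 0 on the closed invariant set and 1 off an open O whose trace on
the hull lies in N. -/
theorem exists_isIndexPair {Y : Type v} {X : Type u} [MetricSpace Y] [MetricSpace X]
    {σ : SkewProductSemiflow Y X} {y₀ : Y} {K N : Set (Y × X)} (hN : σ.IsIsolatingNhd y₀ K N)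
    (hN' : StronglyAdmissible σ.flow N) : ∃ N₁ N₂, σ.IsIndexPair y₀ K N₁ N₂ := by
  have h := σ.isSemiflow_flow
  obtain ⟨O, hO, hKO, hON⟩ := exists_isOpen_of_subset_relInterior hN.inv_subset
  obtain ⟨ρ, hρK, hρO, -⟩ := exists_continuous_zero_one_of_isClosed
    (isClosed_inv h hN.isClosed hN') hO.isClosed_compl
    (Set.disjoint_compl_right_iff_subset.2 hKO)
  have hρN : ∀ z ∈ σ.hullProd y₀, ρ z < 1 → z ∈ N := fun z hz hz' => hON ⟨by
    by_contra hzO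
    have := hρO hzO
    simp only [Pi.one_apply] at this
    linarith, hz⟩
  have hHπ : ∀ z ∈ σ.hullProd y₀, ∀ s w, σ.flow s z = some w → w ∈ σ.hullProd y₀ :=
    fun z hz s w => σ.mem_hullProd_of_flow hz
  obtain ⟨δ, hδ, T, hT⟩ := exists_reach_not_stays (H := σ.hullProd y₀) h hN.isClosed hN'
    ρ.continuous hρN hρK
  have hB := isBasicIndexPair_reach h (σ.isClosed_hullProd y₀) hHπ hN' ρ.continuous
    hρN hT
  refine ⟨_, _, isBasicIndexPair_preimage_r hB y₀, ⟨N, hN, hN', fun p hp => ?_⟩, ?_⟩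
  · have := (closure_minimal reach_subset ((σ.isClosed_hullProd y₀).inter
      (isClosed_le ρ.continuous continuous_const))) hp.1
    exact hρN _ this.1 (this.2.trans_lt (by norm_num))
  · have hO1 : IsOpen {z | ρ z < 1 / 2} := isOpen_lt ρ.continuous continuous_const
    have hO2 : IsOpen {z | ρ z < 3 / 4} := isOpen_lt ρ.continuous continuous_const
    have hK0 : ∀ c > 0, inv σ.flow N ⊆ {z | ρ z < c} := fun c hc z hz => by
      have : ρ z = 0 := hρK hz
      simpa [this] using hc
    refine ⟨_, Set.inter_subset_right, subset_relInterior ?_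
      ((Metric.isOpen_thickening (δ := δ) (E := inv σ.flow N)).inter
        (hO1.inter (h.isOpen_stays_time hO2 T))) ?_, ?_⟩
    · rw [hN.inv_eq]; exact (inv_subset N).trans hN.subset
    · rw [hN.inv_eq]
      exact Set.subset_inter (Metric.self_subset_thickening hδ _) (Set.subset_inter
        (hK0 _ (by norm_num)) fun z hz => (stays_of_mem_inv hz T).mono (hK0 _ (by norm_num)) le_rfl)
    · rintro p ⟨⟨h1, h2, h3⟩, h4⟩
      refine ⟨subset_closure ⟨0, _, h1, fun s hs => ?_, h.zero _⟩, fun hn => hn.2 h3⟩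
      rw [nonpos_iff_eq_zero.1 hs, h.zero, some_mem]
      exact ⟨h4, le_of_lt h2⟩

end SkewProductSemiflow

/-! ### The categorial Conley index -/

section Injectivity

variable {Z : Type u}

lemma sUnion_quotPts {A B : Set Z} : ⋃₀ quotPts A B = A := by
  refine subset_antisymm (Set.sUnion_subset ?_) fun a ha =>
    ⟨cls A B a, Or.inl ⟨a, ha, rfl⟩, ha, Or.inl rfl⟩
  rintro c (⟨a, -, rfl⟩ | rfl)
  · exact fun x hx => hx.1
  · exact Set.inter_subset_left

lemma quotSpace_injective [TopologicalSpace Z] {A B A' B' : Set Z} (hB : B ⊆ A) (hB' : B' ⊆ A')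
    (h : quotSpace A B = quotSpace A' B') : A = A' ∧ B = B' := by
  -- The types of the carrier and the base point depend on the space; a sigma type over the ambient
  -- type turns the equality of spaces into one of plain pairs.
  have h1 := congrArg (fun S : PtdSpace.{u} =>
    (⟨S.ambient, S.carrier, S.pt.1⟩ : Σ T : Type u, Set T × T)) h
  have h2 : (quotPts A B, A ∩ B) = (quotPts A' B', A' ∩ B') := eq_of_heq (Sigma.mk.inj h1).2
  obtain ⟨h3, h4⟩ := Prod.mk.inj h2
  constructor
  · rw [← sUnion_quotPts (A := A) (B := B), h3, sUnion_quotPts]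
  · rwa [Set.inter_eq_self_of_subset_right hB, Set.inter_eq_self_of_subset_right hB'] at h4

end Injectivity

namespace SkewProductSemiflow

variable {Y : Type v} {X : Type u}

lemma quotObj_injective [TopologicalSpace X] {N₁ N₂ M₁ M₂ : Set (ℝ≥0 × X)} (hN : N₂ ⊆ N₁)
    (hM : M₂ ⊆ M₁) (h : quotObj N₁ N₂ = quotObj M₁ M₂) : N₁ = M₁ ∧ N₂ = M₂ :=
  quotSpace_injective hN hM (congrArg CategoryTheory.Quotient.as h)

lemma small_quotObj [TopologicalSpace X] (p : Set (ℝ≥0 × X) → Set (ℝ≥0 × X) → Prop) :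
    Small.{u} {A : HoPtd.{u} | ∃ N₁ N₂, p N₁ N₂ ∧ A = quotObj N₁ N₂} := by
  refine small_subset (s := Set.range fun q : Set (ℝ≥0 × X) × Set (ℝ≥0 × X) => quotObj q.1 q.2) ?_
  rintro A ⟨N₁, N₂, -, rfl⟩
  exact ⟨(N₁, N₂), rfl⟩

variable [MetricSpace Y] [MetricSpace X] {σ : SkewProductSemiflow Y X} {y₀ : Y} {K : Set (Y × X)}

namespace IsIndexPair

variable {N₁ N₂ M₁ M₂ R₁ R₂ : Set (ℝ≥0 × X)}

/-- The canonical morphism between the quotients of two index pairs. -/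
noncomputable def canonHom (hN : σ.IsIndexPair y₀ K N₁ N₂) (hM : σ.IsIndexPair y₀ K M₁ M₂) :
    quotObj N₁ N₂ ⟶ quotObj M₁ M₂ :=
  TamePair.canon σ.isSemiflow_chi hN.toTame hM.toTame (hN.exists_linked hM)

lemma canonHom_self (hN : σ.IsIndexPair y₀ K N₁ N₂) : hN.canonHom hN = 𝟙 _ :=
  TamePair.canon_self σ.isSemiflow_chi _ _

lemma canonHom_comp (hN : σ.IsIndexPair y₀ K N₁ N₂) (hM : σ.IsIndexPair y₀ K M₁ M₂)
    (hR : σ.IsIndexPair y₀ K R₁ R₂) : hN.canonHom hM ≫ hM.canonHom hR = hN.canonHom hR :=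
  TamePair.canon_comp σ.isSemiflow_chi _ _ _

lemma canonHom_incl (hN : σ.IsIndexPair y₀ K N₁ N₂) (hM : σ.IsIndexPair y₀ K M₁ M₂)
    (h₁ : N₁ ⊆ M₁) (h₂ : N₂ ⊆ M₂) : hN.canonHom hM = inclHom h₁ h₂ :=
  TamePair.canon_incl σ.isSemiflow_chi (P := hN.toTame) (Q := hM.toTame) _ h₁ h₂

end IsIndexPair

variable (σ y₀ K)

/-- The subcategory formed by the canonical morphisms. -/
noncomputable def canonSubcat : Subcat HoPtd.{u} where
  obj := {A | ∃ N₁ N₂, σ.IsIndexPair y₀ K N₁ N₂ ∧ A = quotObj N₁ N₂}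
  hom A B := {f | ∃ (N₁ N₂ M₁ M₂ : Set (ℝ≥0 × X)) (hN : σ.IsIndexPair y₀ K N₁ N₂)
    (hM : σ.IsIndexPair y₀ K M₁ M₂) (hA : A = quotObj N₁ N₂) (hB : B = quotObj M₁ M₂),
      f = eqToHom hA ≫ hN.canonHom hM ≫ eqToHom hB.symm}
  src_mem := by
    rintro A B f ⟨N₁, N₂, M₁, M₂, hN, hM, hA, hB, -⟩
    exact ⟨N₁, N₂, hN, hA⟩
  tgt_mem := by
    rintro A B f ⟨N₁, N₂, M₁, M₂, hN, hM, hA, hB, -⟩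
    exact ⟨M₁, M₂, hM, hB⟩
  id_mem := by
    rintro A ⟨N₁, N₂, hN, rfl⟩
    exact ⟨N₁, N₂, N₁, N₂, hN, hN, rfl, rfl, by simp [hN.canonHom_self]⟩
  comp_mem := by
    rintro A B D f g ⟨N₁, N₂, M₁, M₂, hN, hM, rfl, rfl, rfl⟩
      ⟨M₁', M₂', R₁, R₂, hM', hR, hB, rfl, rfl⟩
    -- The middle object determines its index pair, so the two canonical morphisms are composable.
    obtain ⟨rfl, rfl⟩ := quotObj_injective hM.basic.subset hM'.basic.subset hB
    exact ⟨N₁, N₂, R₁, R₂, hN, hR, rfl, rfl, by simp [hN.canonHom_comp hM hR]⟩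

variable {σ y₀ K}

lemma canonHom_mem {N₁ N₂ M₁ M₂ : Set (ℝ≥0 × X)} (hN : σ.IsIndexPair y₀ K N₁ N₂)
    (hM : σ.IsIndexPair y₀ K M₁ M₂) :
    hN.canonHom hM ∈ (canonSubcat σ y₀ K).hom (quotObj N₁ N₂) (quotObj M₁ M₂) :=
  ⟨N₁, N₂, M₁, M₂, hN, hM, rfl, rfl, by simp⟩

lemma eq_canonHom {N₁ N₂ M₁ M₂ : Set (ℝ≥0 × X)} (hN : σ.IsIndexPair y₀ K N₁ N₂)
    (hM : σ.IsIndexPair y₀ K M₁ M₂) {f : quotObj N₁ N₂ ⟶ quotObj M₁ M₂}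
    (hf : f ∈ (canonSubcat σ y₀ K).hom (quotObj N₁ N₂) (quotObj M₁ M₂)) :
    f = hN.canonHom hM := by
  obtain ⟨N₁', N₂', M₁', M₂', hN', hM', hA, hB, rfl⟩ := hf
  obtain ⟨rfl, rfl⟩ := quotObj_injective hN.basic.subset hN'.basic.subset hA
  obtain ⟨rfl, rfl⟩ := quotObj_injective hM.basic.subset hM'.basic.subset hB
  simp

lemma containsIndex_canonSubcat : σ.ContainsIndex y₀ K (canonSubcat σ y₀ K) where
  obj_eq := rfl
  incl_mem hN hM h₁ h₂ := by
    rw [← hN.canonHom_incl hM h₁ h₂]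
    exact canonHom_mem hN hM
  inv_mem hN hM h₁ h₂ := by
    refine ⟨_, canonHom_mem hM hN, ?_, ?_⟩
    · rw [← hN.canonHom_incl hM h₁ h₂, hN.canonHom_comp hM hN, hN.canonHom_self]
    · rw [← hN.canonHom_incl hM h₁ h₂, hM.canonHom_comp hN hM, hM.canonHom_self]

lemma Con_le {S : Subcat HoPtd.{u}} (hS : σ.ContainsIndex y₀ K S) : σ.Con y₀ K ≤ S :=
  ⟨fun _ hA => hA S hS, fun _ _ _ hf => hf S hS⟩

/-- Only the inverses need an argument: each S contains some inverse, and by uniqueness of inverses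
it is always the same one. -/
lemma containsIndex_Con : σ.ContainsIndex y₀ K (σ.Con y₀ K) where
  obj_eq := by
    refine subset_antisymm (fun A hA => hA _ containsIndex_canonSubcat) fun A hA S hS => ?_
    rw [hS.obj_eq]; exact hA
  incl_mem hN hM h₁ h₂ S hS := hS.incl_mem hN hM h₁ h₂
  inv_mem hN hM h₁ h₂ := by
    obtain ⟨g, -, hg1, hg2⟩ :=
      (containsIndex_canonSubcat (σ := σ) (y₀ := y₀) (K := K)).inv_mem hN hM h₁ h₂
    refine ⟨g, fun S hS => ?_, hg1, hg2⟩
    obtain ⟨g', hg', hg1', -⟩ := hS.inv_mem hN hM h₁ h₂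
    have : g = g' := by
      rw [← Category.comp_id g, ← hg1', ← Category.assoc, hg2, Category.id_comp]
    rwa [this]

/-- Compose along the zigzag, using the inverses in S for the inclusions that point backward. -/
lemma ContainsIndex.exists_hom {S : Subcat HoPtd.{u}} (hS : σ.ContainsIndex y₀ K S)
    {N₁ N₂ M₁ M₂ : Set (ℝ≥0 × X)} (hN : σ.IsIndexPair y₀ K N₁ N₂)
    (hM : σ.IsIndexPair y₀ K M₁ M₂) : ∃ f, f ∈ S.hom (quotObj N₁ N₂) (quotObj M₁ M₂) := by
  obtain ⟨T, R₁, R₂, hR, hRN₁, hRM₁, hRN₂, hRM₂⟩ := hN.exists_zigzag hM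
  have hsub : ∀ {A₁ A₂ : Set (ℝ≥0 × X)}, σ.IsIndexPair y₀ K A₁ A₂ →
      A₂ ⊆ {x ∈ A₁ | ¬ Stays (σ.chi y₀) A₂ᶜ T x} := fun hA x hx =>
    ⟨hA.basic.subset hx, fun hs => σ.isSemiflow_chi.stays_mem hs hx⟩
  obtain ⟨f, hf, -⟩ := hS.inv_mem hR (hN.expand T) hRN₁ hRN₂
  obtain ⟨g, hg, -⟩ := hS.inv_mem hM (hM.expand T) subset_rfl (hsub hM)
  exact ⟨_, S.comp_mem (S.comp_mem (hS.incl_mem hN (hN.expand T) subset_rfl (hsub hN)) hf)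
    (S.comp_mem (hS.incl_mem hR (hM.expand T) hRM₁ hRM₂) hg)⟩

end SkewProductSemiflow

end NonautConley

theorem mainTheorem3 {Y : Type v} {X : Type u} [MetricSpace Y] [MetricSpace X]
    (σ : NonautConley.SkewProductSemiflow Y X) (y₀ : Y) (K : Set (Y × X))
    (hK : ∃ N, σ.IsIsolatingNhd y₀ K N ∧ NonautConley.StronglyAdmissible σ.flow N) :
    IsLeast {S : NonautConley.Subcat NonautConley.HoPtd.{u} | σ.ContainsIndex y₀ K S}
      (σ.Con y₀ K) ∧
    (σ.Con y₀ K).obj.Nonempty ∧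
    (σ.Con y₀ K).IsConnectedSimpleSystem := by
  have hcon := NonautConley.SkewProductSemiflow.containsIndex_Con (σ := σ) (y₀ := y₀) (K := K)
  refine ⟨⟨hcon, fun S hS => NonautConley.SkewProductSemiflow.Con_le hS⟩, ?_, ?_, ?_⟩
  · obtain ⟨N, hN, hN'⟩ := hK
    obtain ⟨N₁, N₂, h⟩ := NonautConley.SkewProductSemiflow.exists_isIndexPair hN hN'
    rw [hcon.obj_eq]
    exact ⟨_, N₁, N₂, h, rfl⟩
  · rw [hcon.obj_eq]
    exact NonautConley.SkewProductSemiflow.small_quotObj _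
  · intro A hA B hB
    rw [hcon.obj_eq] at hA hB
    obtain ⟨N₁, N₂, hN, rfl⟩ := hA
    obtain ⟨M₁, M₂, hM, rfl⟩ := hB
    obtain ⟨f, hf⟩ := hcon.exists_hom hN hM
    have hle := NonautConley.SkewProductSemiflow.Con_le (σ := σ) (y₀ := y₀) (K := K)
      NonautConley.SkewProductSemiflow.containsIndex_canonSubcat
    have huniq := fun g hg => NonautConley.SkewProductSemiflow.eq_canonHom hN hM
      (f := g) (hle.2 _ _ hg)
    exact ⟨f, hf, fun g hg => (huniq g hg).trans (huniq f hf).symm⟩
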